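/- Let $F$ be Thompson's group. Its elements are represented by pairs $(T_+,T_-)$ of finite rooted planar binary trees with the same number $n\ge 1$ of leaves, where the element $g(T_+,T_-)$ maps the $i$-th dyadic interval of the subdivision of $[0,1]$ given by $T_-$ affinely onto the $i$-th interval of the subdivision given by $T_+$ (equivalently, it replaces the prefix of binary sequences given by the $i$-th leaf of $T_-$ by the one given by the $i$-th leaf of $T_+$). For such a pair let $\Gamma(T_+,T_-)$ be the plane graph with vertices $1,\dots,n$ on a horizontal line (one for each leaf) and one edge for each caret of $T_+$, drawn in the upper half plane, and of $T_-$, drawn in the lower half plane; the edge of a caret joins the vertex of the first leaf below its left child to the vertex of the first leaf below its right child. The Jones–Thompson group is $$\vec F=\{g\in F : \mathrm{Chr}_{\Gamma(g)}(2)=2\},$$ where $\Gamma(g)=\Gamma(T_+,T_-)$ for a pair representing $g$ and $\mathrm{Chr}$ is the chromatic polynomial; that is, $\Gamma(g)$ has exactly two proper $2$-colourings. Let $g\in\vec F$ be represented by $(T_+,T_-)$ with $n$ leaves. The link diagram $L(T_+,T_-)$ is the medial graph of $\Gamma(T_+,T_-)$, shaded so that the vertices of $\Gamma$ are the black regions,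 with crossings of one type on the upper edges and of the opposite type on the lower edges. It is oriented as the boundary of the Seifert surface formed by the black regions: the black region of a vertex is oriented counterclockwise or clockwise according to its colour $+$ or $-$ in the $2$-colouring of $\Gamma$ whose leftmost vertex has colour $+$. The types of the crossings are such that, for this orientation, the upper crossings are positive and the lower ones are negative. Let $\vec L(T_+,T_-)$ be the resulting oriented link, let $V_{\vec L}(t)$ be its Jones polynomial, $V_{\vec L}(t)=(-A^3)^{-\mathrm{wr}(\vec L)}\langle L\rangle(A)$ with $t^{-1/4}=A$, where $\mathrm{wr}$ is the writhe and $\langle\cdot\rangle$ the Kauffman bracket with $\langle O\rangle=1$, and define the renormalized Jones function by $$V_g(t)=V_{\vec L(T_+,T_-)}(t)\,\bigl(-t^{-1/2}-t^{1/2}\bigr)^{-n+1}.$$ **Theorem.** Let $t\in\{1,\ i,\ e^{i\pi/3},\ e^{-i\pi/3}\}$. Then $V_g(t)$ is well defined for $g\in\vec F$, i.e. it depends neither on the pair $(T_+,T_-)$ representing $g$ nor on the choice of the fourth root $t^{-1/4}$; and the function $g\mapsto V_g(t)$ is of positive type on $\vec F$, i.e. for all $r$ and $g_1,\dots,g_r\in\vec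 F$ the matrix $\bigl(V_{g_ig_j^{-1}}(t)\bigr)_{i,j=1}^r$ is positive semi-definite. -/

import Mathlib

open scoped ComplexOrder

noncomputable section

namespace JonesThompson

/-! ### Binary trees -/

/-- Finite rooted planar binary trees: `leaf` is the one-vertex tree, `node l r` is a root caret
whose left and right children are the roots of `l` and `r`. -/
inductive BTree : Type
  | leaf : BTree
  | node : BTree → BTree → BTree

namespace BTree

/-- The number of leaves. The leaves of `T` are numbered from left to right by
`Fin T.leaves`. -/
def leaves : BTree → ℕ
  | leaf => 1
  | node l r => l.leaves + r.leaves

/-- The leaf of `node l r` that is the leaf `v` of `l`. -/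
def leftLeaf (l r : BTree) (v : Fin l.leaves) : Fin (node l r).leaves := Fin.castAdd r.leaves v

/-- The leaf of `node l r` that is the leaf `v` of `r`. -/
def rightLeaf (l r : BTree) (v : Fin r.leaves) : Fin (node l r).leaves := Fin.natAdd l.leaves v

/-- The leftmost leaf. -/
def first : (T : BTree) → Fin T.leaves
  | leaf => (0 : Fin 1)
  | node l r => leftLeaf l r l.first

/-- The carets (interior vertices) of a tree. In `node l r`, `none` is the root caret. -/
def Caret : BTree → Type
  | leaf => Empty
  | node l r => Option (l.Caret ⊕ r.Caret)

/-- The root caret of `node l r`. -/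
def rootCaret (l r : BTree) : (node l r).Caret := none

/-- The caret of `node l r` that is the caret `x` of `l`. -/
def leftCaret (l r : BTree) (x : l.Caret) : (node l r).Caret := some (Sum.inl x)

/-- The caret of `node l r` that is the caret `x` of `r`. -/
def rightCaret (l r : BTree) (x : r.Caret) : (node l r).Caret := some (Sum.inr x)

/-- There are finitely many carets. -/
instance instFintypeCaret : (T : BTree) → Fintype T.Caret
  | leaf => inferInstanceAs (Fintype Empty)
  | node l r =>
    letI := instFintypeCaret l
    letI := instFintypeCaret r
    inferInstanceAs (Fintype (Option (l.Caret ⊕ r.Caret)))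

/-- Equality of carets is decidable. -/
instance instDecidableEqCaret : (T : BTree) → DecidableEq T.Caret
  | leaf => inferInstanceAs (DecidableEq Empty)
  | node l r =>
    letI := instDecidableEqCaret l
    letI := instDecidableEqCaret r
    inferInstanceAs (DecidableEq (Option (l.Caret ⊕ r.Caret)))

/-- The binary addresses of the leaves, from left to right
(`false` means left child, `true` means right child). -/
def addresses : BTree → List (List Bool)
  | leaf => [[]]
  | node l r => l.addresses.map (List.cons false) ++ r.addresses.map (List.cons true)

/-- The half `Γ`-graph of a tree. Its vertices are the leaves (the vertex `i` is drawn on the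
horizontal axis, immediately to the left of the leaf `i`). It has one edge for every caret, namely
the arc that crosses the left edge of that caret and no other edge of the tree: it joins the first
leaf below the left child to the first leaf below the right child. `edge x` is the pair
(left endpoint, right endpoint). -/
def edge : (T : BTree) → T.Caret → Fin T.leaves × Fin T.leaves
  | leaf, x => Empty.elim x
  | node l r, none => (leftLeaf l r l.first, rightLeaf l r r.first)
  | node l r, some (Sum.inl x) =>
    (leftLeaf l r (l.edge x).1, leftLeaf l r (l.edge x).2)
  | node l r, some (Sum.inr x) =>
    (rightLeaf l r (r.edge x).1, rightLeaf l r (r.edge x).2)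

end BTree

/-- A pair of trees `(T₊, T₋)` with the same number of leaves: `up` is `T₊` and `down` is `T₋`. -/
structure TreePair where
  up : BTree
  down : BTree
  same : up.leaves = down.leaves

/-- The pair `(T₊, T₋)` represents the bijection `g` of the Cantor set of infinite binary
sequences if, for every `i`, `g` replaces the prefix given by the `i`-th leaf of `T₋` by the `i`-th
leaf of `T₊`. (On `[0,1]`: `g` maps the `i`-th dyadic interval of the subdivision `T₋` affinely
and increasingly onto the `i`-th dyadic interval of the subdivision `T₊`.) -/
def TreePair.Represents (D : TreePair) (g : Equiv.Perm (Stream' Bool)) : Prop :=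
  List.Forall₂ (fun u v => ∀ w : Stream' Bool, g (v ++ₛ w) = u ++ₛ w)
    D.up.addresses D.down.addresses

/-- The number of vertices of `Γ(T₊, T₋)`, that is, the number `n` of leaves of `T₊` and `T₋`. -/
abbrev TreePair.size (D : TreePair) : ℕ := D.up.leaves

/-- The leftmost vertex of `Γ(T₊, T₋)`. -/
def TreePair.first (D : TreePair) : Fin D.size := D.up.first

/-- The edges of `Γ(T₊, T₋)` coming from `T₊`, as pairs (left endpoint, right endpoint). -/
def TreePair.upEdge (D : TreePair) (x : D.up.Caret) : Fin D.size × Fin D.size :=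
  D.up.edge x

/-- The edges of `Γ(T₊, T₋)` coming from `T₋`; the `i`-th leaf of `T₋` is identified with the
`i`-th leaf of `T₊`. -/
def TreePair.downEdge (D : TreePair) (x : D.down.Caret) : Fin D.size × Fin D.size :=
  (Fin.cast D.same.symm (D.down.edge x).1, Fin.cast D.same.symm (D.down.edge x).2)

/-- The adjacency graph of `Γ(T₊, T₋)`, which is obtained by gluing the half graphs of `T₊` (in the
upper half plane) and of `T₋` (in the lower half plane) along their vertices. (Multiplicities of
edges do not matter for colourings, and there are no loops.) -/
def TreePair.graph (D : TreePair) : SimpleGraph (Fin D.size) :=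
  SimpleGraph.fromRel fun i j => (∃ x, D.upEdge x = (i, j)) ∨ (∃ x, D.downEdge x = (i, j))

/-! ### Auxiliary facts on trees, needed to see that the groups below are groups -/

namespace BTree

/-- `Expand T T'`: the tree `T'` arises from `T` by attaching one caret to one leaf. -/
inductive Expand : BTree → BTree → Prop
  | here : Expand leaf (node leaf leaf)
  | left {l l' : BTree} (r : BTree) : Expand l l' → Expand (node l r) (node l' r)
  | right (l : BTree) {r r' : BTree} : Expand r r' → Expand (node l r) (node l r')

theorem expand_addresses {T T' : BTree} (h : Expand T T') :
    ∃ p u q, T.addresses = p ++ u :: q ∧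
      T'.addresses = p ++ (u ++ [false]) :: (u ++ [true]) :: q := by
  induction h with
  | here => exact ⟨[], [], [], rfl, rfl⟩
  | left r _ ih =>
    obtain ⟨p, u, q, h1, h2⟩ := ih
    exact ⟨p.map (List.cons false), false :: u,
      q.map (List.cons false) ++ r.addresses.map (List.cons true),
      by simp [addresses, h1], by simp [addresses, h2]⟩
  | right l _ ih =>
    obtain ⟨p, u, q, h1, h2⟩ := ih
    exact ⟨l.addresses.map (List.cons false) ++ p.map (List.cons true), true :: u,
      q.map (List.cons true), by simp [addresses, h1], by simp [addresses, h2]⟩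

theorem exists_expand (T : BTree) : ∀ p u q, T.addresses = p ++ u :: q →
    ∃ T', Expand T T' ∧ T'.addresses = p ++ (u ++ [false]) :: (u ++ [true]) :: q := by
  induction T with
  | leaf =>
    intro p u q h
    have hp : p = [] := by
      cases p with
      | nil => rfl
      | cons a p => simp [addresses] at h
    subst hp
    simp only [addresses, List.nil_append, List.cons.injEq] at h
    obtain ⟨rfl, rfl⟩ := h
    exact ⟨_, Expand.here, rfl⟩
  | node l r ihl ihr =>
    intro p u q h
    simp only [addresses] at h
    rcases List.append_eq_append_iff.1 h with ⟨a, h1, h2⟩ | ⟨c, h1, h2⟩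
    · obtain ⟨r1, r2, h3, h4, h5⟩ := List.map_eq_append_iff.1 h2
      obtain ⟨u', q', h6, h7, h8⟩ := List.map_eq_cons_iff.1 h5
      subst h6
      obtain ⟨r', hr, hr'⟩ := ihr _ _ _ h3
      refine ⟨node l r', Expand.right l hr, ?_⟩
      simp [addresses, hr', h1, ← h4, ← h7, ← h8]
    · cases c with
      | nil =>
        simp only [List.nil_append] at h2
        obtain ⟨u', q', h6, h7, h8⟩ := List.map_eq_cons_iff.1 h2.symm
        obtain ⟨r', hr, hr'⟩ := ihr [] u' q' h6
        refine ⟨node l r', Expand.right l hr, ?_⟩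
        simp [addresses, hr', h1, ← h7, ← h8]
      | cons c0 c =>
        simp only [List.cons_append, List.cons.injEq] at h2
        obtain ⟨rfl, rfl⟩ := h2
        obtain ⟨l1, l2, h3, h4, h5⟩ := List.map_eq_append_iff.1 h1
        obtain ⟨u', q', h6, h7, h8⟩ := List.map_eq_cons_iff.1 h5
        subst h6
        obtain ⟨l', hl, hl'⟩ := ihl _ _ _ h3
        refine ⟨node l' r, Expand.left r hl, ?_⟩
        simp [addresses, hl', ← h4, ← h7, ← h8]

/-- `T'` arises from `T` by attaching finitely many carets. -/
def Refines (T T' : BTree) : Prop := Relation.ReflTransGen Expand T T'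

theorem refines_node {l l' r r' : BTree} (hl : Refines l l') (hr : Refines r r') :
    Refines (node l r) (node l' r') :=
  Relation.ReflTransGen.trans
    (Relation.ReflTransGen.lift (fun t => node t r) (fun _ _ h => Expand.left r h) _ _ hl)
    (Relation.ReflTransGen.lift (fun t => node l' t) (fun _ _ h => Expand.right l' h) _ _ hr)

theorem leaf_refines (T : BTree) : Refines leaf T := by
  induction T with
  | leaf => exact Relation.ReflTransGen.refl
  | node l r ihl ihr => exact Relation.ReflTransGen.head Expand.here (refines_node ihl ihr)

theorem exists_common (T : BTree) : ∀ S : BTree, ∃ R, Refines T R ∧ Refines S R := by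
  induction T with
  | leaf => exact fun S => ⟨S, leaf_refines S, Relation.ReflTransGen.refl⟩
  | node l r ihl ihr =>
    intro S
    cases S with
    | leaf => exact ⟨node l r, Relation.ReflTransGen.refl, leaf_refines _⟩
    | node l' r' =>
      obtain ⟨a, h1, h2⟩ := ihl l'
      obtain ⟨b, h3, h4⟩ := ihr r'
      exact ⟨node a b, refines_node h1 h3, refines_node h2 h4⟩

/-- The parity of the number of right turns of an address (`true` if it is even). -/
def parity : List Bool → Bool
  | [] => true
  | b :: u => if b then !(parity u) else parity u

theorem parity_append_false (u : List Bool) : parity (u ++ [false]) = parity u := by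
  induction u with
  | nil => rfl
  | cons b u ih => simp [parity, ih]

theorem parity_append_true (u : List Bool) : parity (u ++ [true]) = !parity u := by
  induction u with
  | nil => rfl
  | cons b u ih => cases b <;> simp [parity, ih]

/-- The parities of the addresses of the leaves. -/
def word (T : BTree) : List Bool := T.addresses.map parity

theorem word_node (l r : BTree) : (node l r).word = l.word ++ r.word.map not := by
  simp [word, addresses, parity, Function.comp_def]

theorem length_addresses (T : BTree) : T.addresses.length = T.leaves := by
  induction T with
  | leaf => rfl
  | node l r ihl ihr => simp [addresses, leaves, ihl, ihr]

/-- `word` as a function on the leaves. -/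
def side : (T : BTree) → Fin T.leaves → Bool
  | leaf => fun _ => true
  | node l r => Fin.addCases l.side (fun i => !(r.side i))

theorem side_left (l r : BTree) (v : Fin l.leaves) :
    (node l r).side (leftLeaf l r v) = l.side v := by
  simp [side, leftLeaf]

theorem side_right (l r : BTree) (v : Fin r.leaves) :
    (node l r).side (rightLeaf l r v) = !(r.side v) := by
  simp [side, rightLeaf]

theorem leaf_cases {l r : BTree} {motive : Fin (node l r).leaves → Prop}
    (left : ∀ v, motive (leftLeaf l r v)) (right : ∀ v, motive (rightLeaf l r v))
    (v : Fin (node l r).leaves) : motive v :=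
  Fin.addCases (m := l.leaves) (n := r.leaves) left right v

theorem ofFn_side (T : BTree) : List.ofFn T.side = T.word := by
  induction T with
  | leaf => rfl
  | node l r ihl ihr =>
    rw [word_node, ← ihl, ← ihr, List.map_ofFn]
    change List.ofFn (n := l.leaves + r.leaves) _ = _
    rw [← List.ofFn_fin_append]
    congr 1

theorem side_first (T : BTree) : T.side T.first = true := by
  induction T with
  | leaf => rfl
  | node l r ihl ihr => simpa [side_left, first] using ihl

theorem side_edge (T : BTree) (x : T.Caret) : T.side (T.edge x).1 ≠ T.side (T.edge x).2 := by
  induction T with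
  | leaf => exact Empty.elim x
  | node l r ihl ihr =>
    match x with
    | none => simp [side_left, side_right, edge, side_first]
    | some (Sum.inl x) => simpa [side_left, edge] using ihl x
    | some (Sum.inr x) => simpa [side_right, edge] using ihr x

theorem eq_side (T : BTree) (c : Fin T.leaves → Bool)
    (h : ∀ x, c (T.edge x).1 ≠ c (T.edge x).2) (i : Fin T.leaves) :
    c i = (T.side i == c T.first) := by
  induction T with
  | leaf =>
    have : i = (leaf).first := Subsingleton.elim (α := Fin 1) _ _
    subst this
    simp [side]
  | node l r ihl ihr =>
    have hl := ihl (fun j => c (leftLeaf l r j)) (fun x => h (leftCaret l r x))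
    have hr := ihr (fun j => c (rightLeaf l r j)) (fun x => h (rightCaret l r x))
    have h0 : c (leftLeaf l r l.first) ≠ c (rightLeaf l r r.first) := h (rootCaret l r)
    induction i using leaf_cases with
    | left j => simpa [side_left, first] using hl j
    | right j =>
      have := hr j
      simp only [side_right, first]
      rw [this]
      revert h0
      cases c (leftLeaf l r l.first) <;> cases c (rightLeaf l r r.first) <;> simp

end BTree

theorem TreePair.adj_up (D : TreePair) (x : D.up.Caret) :
    D.graph.Adj (D.upEdge x).1 (D.upEdge x).2 := by
  refine (SimpleGraph.fromRel_adj _ _ _).2 ⟨fun h => D.up.side_edge x ?_, Or.inl (Or.inl ⟨x, rfl⟩)⟩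
  exact congrArg D.up.side h

theorem TreePair.adj_down (D : TreePair) (x : D.down.Caret) :
    D.graph.Adj (D.downEdge x).1 (D.downEdge x).2 := by
  refine (SimpleGraph.fromRel_adj _ _ _).2
    ⟨fun h => D.down.side_edge x ?_, Or.inl (Or.inr ⟨x, rfl⟩)⟩
  exact congrArg D.down.side (Fin.cast_injective D.same.symm h)

theorem TreePair.coloring_up (D : TreePair) (c : D.graph.Coloring Bool) (i : Fin D.size) :
    c i = (D.up.side i == c D.first) :=
  D.up.eq_side c (fun x => c.valid (D.adj_up x)) i

theorem BTree.cast_first {T S : BTree} (h : T.leaves = S.leaves) :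
    Fin.cast h T.first = S.first := by
  have aux : ∀ T : BTree, (T.first : ℕ) = 0 := by
    intro T
    induction T with
    | leaf => rfl
    | node l r ihl _ => simpa [BTree.first, BTree.leftLeaf] using ihl
  exact Fin.ext (by simp [aux])

theorem TreePair.coloring_down (D : TreePair) (c : D.graph.Coloring Bool) (i : Fin D.size) :
    c i = (D.down.side (Fin.cast D.same i) == c D.first) := by
  have := D.down.eq_side (fun j => c (Fin.cast D.same.symm j)) (fun x => c.valid (D.adj_down x))
    (Fin.cast D.same i)
  have hf : Fin.cast D.same.symm D.down.first = D.first := BTree.cast_first D.same.symm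
  rw [hf] at this
  exact this

theorem TreePair.card_coloring (D : TreePair) :
    Nat.card (D.graph.Coloring Bool) = 2 ↔ D.up.word = D.down.word := by
  have key : D.up.word = D.down.word ↔ ∀ i, D.up.side i = D.down.side (Fin.cast D.same i) := by
    rw [← BTree.ofFn_side, ← BTree.ofFn_side, List.ofFn_inj']
    constructor
    · intro h i
      obtain ⟨U, V, hs⟩ := D
      simp only [Sigma.mk.injEq] at h
      obtain ⟨h1, h2⟩ := h
      have aux : ∀ (m n : ℕ) (e : m = n) (f : Fin m → Bool) (g : Fin n → Bool) (i : Fin m),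
          f ≍ g → f i = g (Fin.cast e i) := by
        intro m n e f g i hfg
        subst e
        rw [eq_of_heq hfg]
        rfl
      exact aux _ _ _ _ _ _ h2
    · intro h
      refine Sigma.ext D.same ?_
      have aux : ∀ (m n : ℕ) (e : m = n) (f : Fin m → Bool) (g : Fin n → Bool),
          (∀ i, f i = g (Fin.cast e i)) → f ≍ g := by
        intro m n e f g hfg
        subst e
        exact heq_of_eq (funext hfg)
      exact aux _ _ D.same _ _ h
  rw [key]
  constructor
  · intro h i
    have : Nonempty (D.graph.Coloring Bool) := by
      by_contra hne
      rw [not_nonempty_iff] at hne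
      simp at h
    obtain ⟨c⟩ := this
    have h1 := D.coloring_up c i
    have h2 := D.coloring_down c i
    rw [h1] at h2
    revert h2
    cases D.up.side i <;> cases D.down.side (Fin.cast D.same i) <;> cases c D.first <;> simp
  · intro h
    have hval : ∀ b : Bool, ∀ {v w : Fin D.size}, D.graph.Adj v w →
        (D.up.side v == b) ≠ (D.up.side w == b) := by
      intro b v w hvw
      have hne : D.up.side v ≠ D.up.side w := by
        have hrel : ∀ i j : Fin D.size,
            ((∃ x, D.upEdge x = (i, j)) ∨ (∃ x, D.downEdge x = (i, j))) →
            D.up.side i ≠ D.up.side j := by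
          rintro i j (⟨x, hx⟩ | ⟨x, hx⟩)
          · have := D.up.side_edge x
            have h1 : D.up.edge x = (i, j) := hx
            rw [h1] at this
            exact this
          · have := D.down.side_edge x
            rw [TreePair.downEdge, Prod.mk.injEq] at hx
            rw [h, h, ← hx.1, ← hx.2]
            exact this
        rcases ((SimpleGraph.fromRel_adj _ _ _).1 hvw).2 with h1 | h1
        · exact hrel _ _ h1
        · exact (hrel _ _ h1).symm
      revert hne
      cases D.up.side v <;> cases D.up.side w <;> cases b <;> simp
    let e : D.graph.Coloring Bool ≃ Bool :=
      { toFun := fun c => c D.first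
        invFun := fun b => SimpleGraph.Coloring.mk (fun i => (D.up.side i == b)) (hval b)
        left_inv := by
          intro c
          apply RelHom.ext
          intro i
          exact (D.coloring_up c i).symm
        right_inv := by
          intro b
          change (D.up.side D.up.first == b) = b
          rw [BTree.side_first]
          simp }
    rw [Nat.card_congr e]
    simp

theorem TreePair.Represents.expand {D : TreePair} {g : Equiv.Perm (Stream' Bool)}
    (h : D.Represents g) {R : BTree} (hR : D.down.Expand R) :
    ∃ D' : TreePair, D'.Represents g ∧ D'.down = R ∧
      (D.up.word = D.down.word → D'.up.word = D'.down.word) := by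
  obtain ⟨p, u, q, h1, h2⟩ := BTree.expand_addresses hR
  have h0 : List.Forall₂ (fun u v => ∀ w : Stream' Bool, g (v ++ₛ w) = u ++ₛ w)
    D.up.addresses D.down.addresses := h
  rw [h1] at h0
  obtain ⟨p', q0, hp, hq0, hup⟩ : ∃ p' q0, List.Forall₂
      (fun u v => ∀ w : Stream' Bool, g (v ++ₛ w) = u ++ₛ w) p' p ∧ List.Forall₂
      (fun u v => ∀ w : Stream' Bool, g (v ++ₛ w) = u ++ₛ w) q0 (u :: q) ∧
      D.up.addresses = p' ++ q0 :=
    ⟨_, _, List.forall₂_take_append _ _ _ h0, List.forall₂_drop_append _ _ _ h0,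
      (List.take_append_drop _ _).symm⟩
  obtain ⟨u', q', hu, hq, rfl⟩ := List.forall₂_cons_right_iff.1 hq0
  obtain ⟨U, hU, hU'⟩ := BTree.exists_expand _ _ _ _ hup
  have hlen := hp.length_eq
  have hlen' := hq.length_eq
  refine ⟨⟨U, R, ?_⟩, ?_, rfl, ?_⟩
  · rw [← BTree.length_addresses, ← BTree.length_addresses, h2, hU']
    simp [hlen, hlen']
  · change List.Forall₂ _ U.addresses R.addresses
    rw [h2, hU']
    refine List.rel_append hp (List.Forall₂.cons ?_ (List.Forall₂.cons ?_ hq))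
    · intro w
      rw [Stream'.append_append_stream, Stream'.append_append_stream]
      exact hu _
    · intro w
      rw [Stream'.append_append_stream, Stream'.append_append_stream]
      exact hu _
  · intro hw
    simp only [BTree.word, hup, h1, h2, hU', List.map_append, List.map_cons] at hw ⊢
    obtain ⟨ha, hb⟩ := List.append_inj hw (by simp [hlen])
    obtain ⟨hb, hc⟩ := List.cons.inj hb
    simp [BTree.parity_append_false, BTree.parity_append_true, ha, hb, hc]

theorem TreePair.Represents.refine {D : TreePair} {g : Equiv.Perm (Stream' Bool)}
    (h : D.Represents g) {R : BTree} (hR : D.down.Refines R) :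
    ∃ D' : TreePair, D'.Represents g ∧ D'.down = R ∧
      (D.up.word = D.down.word → D'.up.word = D'.down.word) := by
  induction hR with
  | refl => exact ⟨D, h, rfl, id⟩
  | tail _ hstep ih =>
    obtain ⟨D', h1, h2, h3⟩ := ih
    subst h2
    obtain ⟨D'', h4, h5, h6⟩ := h1.expand hstep
    exact ⟨D'', h4, h5, fun hw => h6 (h3 hw)⟩

/-- The pair `(T₋, T₊)`. -/
def TreePair.swap (D : TreePair) : TreePair := ⟨D.down, D.up, D.same.symm⟩

theorem TreePair.Represents.inv {D : TreePair} {g : Equiv.Perm (Stream' Bool)}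
    (h : D.Represents g) : D.swap.Represents g⁻¹ := by
  refine List.Forall₂.flip (List.Forall₂.imp ?_ h)
  intro u v huv w
  rw [← huv w]
  simp

theorem TreePair.Represents.comp {D E : TreePair} {g f : Equiv.Perm (Stream' Bool)}
    (hD : D.Represents g) (hE : E.Represents f) :
    ∃ P : TreePair, P.Represents (g * f) ∧
      (D.up.word = D.down.word → E.up.word = E.down.word → P.up.word = P.down.word) := by
  obtain ⟨R, hR1, hR2⟩ := BTree.exists_common D.down E.up
  obtain ⟨D', h1, h2, h3⟩ := hD.refine hR1
  obtain ⟨E', h4, h5, h6⟩ := hE.inv.refine (R := R) hR2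
  refine ⟨⟨D'.up, E'.up, ?_⟩, ?_, ?_⟩
  · rw [D'.same, E'.same, h2, h5]
  · have h7 := h4.inv
    rw [inv_inv] at h7
    change List.Forall₂ _ D'.up.addresses E'.up.addresses
    change List.Forall₂ _ E'.down.addresses E'.up.addresses at h7
    change List.Forall₂ _ D'.up.addresses D'.down.addresses at h1
    rw [h2] at h1
    rw [h5] at h7
    have aux : ∀ a b c : List (List Bool),
        List.Forall₂ (fun u v => ∀ w : Stream' Bool, g (v ++ₛ w) = u ++ₛ w) a b →
        List.Forall₂ (fun u v => ∀ w : Stream' Bool, f (v ++ₛ w) = u ++ₛ w) b c →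
        List.Forall₂ (fun u v => ∀ w : Stream' Bool, (g * f) (v ++ₛ w) = u ++ₛ w) a c := by
      intro a b c hab
      induction hab generalizing c with
      | nil => intro h; cases h; exact List.Forall₂.nil
      | cons hx _ ih =>
        intro h
        cases h with
        | cons hy hys =>
          refine List.Forall₂.cons (fun w => ?_) (ih _ hys)
          rw [Equiv.Perm.mul_apply, hy, hx]
    exact aux _ _ _ h1 h7
  · intro hw1 hw2
    have h8 := h3 hw1
    have h9 := h6 hw2.symm
    change D'.up.word = E'.up.word
    rw [h8, h9, h2, h5]

/-! ### The Thompson group and the Jones–Thompson group -/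

/-- Thompson's group `F`: the group of all bijections of the Cantor set `{0,1}^ℕ` that are
represented by a pair of trees. The product of the elements given by `(T₊, T)` and `(T, T₋)` is
the element given by `(T₊, T₋)`. -/
def thompsonF : Subgroup (Equiv.Perm (Stream' Bool)) where
  carrier := {g | ∃ D : TreePair, D.Represents g}
  mul_mem' := by
    rintro g f ⟨D, hD⟩ ⟨E, hE⟩
    obtain ⟨P, hP, _⟩ := hD.comp hE
    exact ⟨P, hP⟩
  one_mem' := ⟨⟨BTree.leaf, BTree.leaf, rfl⟩, List.Forall₂.cons (fun _ => rfl) List.Forall₂.nil⟩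
  inv_mem' := by
    rintro g ⟨D, hD⟩
    exact ⟨D.swap, hD.inv⟩

/-- The Jones–Thompson group: the elements of `F` whose `Γ`-graph has exactly two proper
colourings by two colours, i.e. the value at `2` of its chromatic polynomial is `2`.
(Attaching opposite carets to a pair of trees adds to `Γ` a vertex which is joined
to exactly one old vertex, so this does not depend on the representing pair of trees.) -/
def orientedF : Subgroup thompsonF where
  carrier := {g | ∃ D : TreePair, D.Represents g.1 ∧ Nat.card (D.graph.Coloring Bool) = 2}
  mul_mem' := by
    rintro g f ⟨D, hD, hD'⟩ ⟨E, hE, hE'⟩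
    obtain ⟨P, hP, hP'⟩ := hD.comp hE
    exact ⟨P, hP, P.card_coloring.2 (hP' (D.card_coloring.1 hD') (E.card_coloring.1 hE'))⟩
  one_mem' := ⟨⟨BTree.leaf, BTree.leaf, rfl⟩,
    List.Forall₂.cons (fun _ => rfl) List.Forall₂.nil, (TreePair.card_coloring _).2 rfl⟩
  inv_mem' := by
    rintro g ⟨D, hD, hD'⟩
    exact ⟨D.swap, hD.inv, (TreePair.card_coloring _).2 (D.card_coloring.1 hD').symm⟩

/-! ### Link diagrams, writhe, Kauffman bracket, Jones polynomial -/

/-- The ends of the strands of a link diagram with crossings `X` and marked points `P`. The four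
ends at a crossing `x` are `(x, 0), (x, 1), (x, 2), (x, 3)` in counterclockwise order, where `0`
and `2` belong to the lower (under-crossing) strand and `1` and `3` to the upper (over-crossing)
strand. A marked point is an ordinary, non-crossing point of the link; it has two ends. -/
abbrev Ends (X P : Type) : Type := (X × Fin 4) ⊕ (P × Bool)

/-- A (non-oriented) link diagram in combinatorial form (a planar diagram code): crossings, marked
points, and arcs without crossings that match the ends in pairs. -/
structure LinkDiagram where
  Crossing : Type
  Point : Type
  fintypeCrossing : Fintype Crossing
  decEqCrossing : DecidableEq Crossing
  arcs : List (Ends Crossing Point × Ends Crossing Point)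
  nodup : (arcs.flatMap fun a => [a.1, a.2]).Nodup
  mem_ends : ∀ e, e ∈ arcs.flatMap fun a => [a.1, a.2]

attribute [instance] LinkDiagram.fintypeCrossing LinkDiagram.decEqCrossing

namespace LinkDiagram

/-- An orientation of the link. `inward e = true` means that, at the end `e`, the orientation
points towards the crossing or marked point to which `e` belongs. -/
structure Orientation (L : LinkDiagram) where
  inward : Ends L.Crossing L.Point → Bool
  through_crossing : ∀ (x : L.Crossing) (i : Fin 4),
    inward (Sum.inl (x, i + 2)) = !inward (Sum.inl (x, i))
  through_point : ∀ p : L.Point, inward (Sum.inr (p, true)) = !inward (Sum.inr (p, false))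
  along_arc : ∀ a ∈ L.arcs, inward a.1 = !inward a.2

/-- The sign of a crossing. Say that the under-strand runs from `0` (south) to `2` (north), `1` is
east and `3` is west. The crossing is positive if the over-strand runs from west to east, and
negative otherwise. -/
def crossingSign {L : LinkDiagram} (o : L.Orientation) (x : L.Crossing) : ℤ :=
  if o.inward (Sum.inl (x, 0)) = o.inward (Sum.inl (x, 1)) then -1 else 1

/-- The writhe: the sum of the signs of the crossings. -/
def writhe {L : LinkDiagram} (o : L.Orientation) : ℤ := ∑ x, crossingSign o x

/-- A state chooses a smoothing at each crossing, `true` for `A` and `false` for `A⁻¹`. The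
`A`-smoothing joins the two regions swept out by the over-strand when it is turned
counterclockwise, that is, the region between `1` and `2` and the region between `3` and `0`; so
it connects `0` to `1` and `2` to `3`. The other smoothing connects `1` to `2` and `3` to `0`.
`Joined s` is the relation that generates the connectedness of ends in the smoothed diagram. -/
inductive Joined (L : LinkDiagram) (s : L.Crossing → Bool) :
    Ends L.Crossing L.Point → Ends L.Crossing L.Point → Prop
  | arc (a) : a ∈ L.arcs → Joined L s a.1 a.2
  | point (p : L.Point) : Joined L s (Sum.inr (p, true)) (Sum.inr (p, false))
  | smoothA₁ (x : L.Crossing) : s x = true → Joined L s (Sum.inl (x, 0)) (Sum.inl (x, 1))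
  | smoothA₂ (x : L.Crossing) : s x = true → Joined L s (Sum.inl (x, 2)) (Sum.inl (x, 3))
  | smoothB₁ (x : L.Crossing) : s x = false → Joined L s (Sum.inl (x, 1)) (Sum.inl (x, 2))
  | smoothB₂ (x : L.Crossing) : s x = false → Joined L s (Sum.inl (x, 3)) (Sum.inl (x, 0))

/-- The number of closed curves in the smoothed diagram (`Quot` is the quotient by the equivalence
relation generated by `Joined`). -/
def loops (L : LinkDiagram) (s : L.Crossing → Bool) : ℕ := Nat.card (Quot (L.Joined s))

/-- The Kauffman bracket `⟨L⟩(A)` at the complex number `A`, normalized by `⟨O⟩ = 1`. -/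
def bracket (L : LinkDiagram) (A : ℂ) : ℂ :=
  ∑ s : L.Crossing → Bool,
    (∏ x, if s x then A else A⁻¹) * (-A ^ 2 - A⁻¹ ^ 2) ^ (L.loops s - 1)

/-- The Jones polynomial `V(t)` of the oriented link, evaluated at `t^{-1/4} = A`. -/
def jones (L : LinkDiagram) (o : L.Orientation) (A : ℂ) : ℂ :=
  (-A ^ 3) ^ (-writhe o) * L.bracket A

end LinkDiagram

/-! ### The link diagram of a pair of trees -/

/-- The four ends at the crossing placed on an edge of the half graph, seen from that edge: near
its left or right endpoint, and on the outer side of the edge (away from the horizontal axis) or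
on its inner side. -/
inductive Corner : Type
  | outerLeft | innerLeft | innerRight | outerRight

namespace BTree

variable {E : Type}

/-- The half of the medial graph lying over (or under) the axis. Each vertex `v` of the half graph
carries a black region; the boundary of this region crosses the axis on the left of `v`, in the end
`p v false`, and on the right of `v`, in the end `p v true`. The ends at the crossing of the edge
of the caret `x` are `q x k`.
`top` is the end that follows `p T.first false` along the boundary of the black region of the
leftmost vertex. -/
def top : (T : BTree) → (Fin T.leaves → Bool → E) → (T.Caret → Corner → E) → E
  | leaf, p, _ => p (0 : Fin 1) true
  | node l r, _, q => q (rootCaret l r) Corner.outerLeft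

/-- All arcs of the half medial graph except the one that joins `p T.first false` to `top`. The
root caret of `node l r` adds an outermost edge, from the leftmost vertex of `l` to the leftmost
vertex of `r`, and its crossing interrupts the boundaries of the black regions of these two
vertices. -/
def innerArcs : (T : BTree) → (Fin T.leaves → Bool → E) → (T.Caret → Corner → E) → List (E × E)
  | leaf, _, _ => []
  | node l r, p, q =>
    let pl := fun v => p (leftLeaf l r v)
    let pr := fun v => p (rightLeaf l r v)
    let ql := fun x => q (leftCaret l r x)
    let qr := fun x => q (rightCaret l r x)
    (l.top pl ql, q (rootCaret l r) Corner.innerLeft) ::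
    (pr r.first false, q (rootCaret l r) Corner.innerRight) ::
    (r.top pr qr, q (rootCaret l r) Corner.outerRight) ::
    (l.innerArcs pl ql ++ r.innerArcs pr qr)

/-- All arcs of the half medial graph (the semi-link of the tree). -/
def semiLink (T : BTree) (p : Fin T.leaves → Bool → E) (q : T.Caret → Corner → E) :
    List (E × E) :=
  (p T.first false, T.top p q) :: T.innerArcs p q

theorem card_caret (T : BTree) : Fintype.card T.Caret + 1 = T.leaves := by
  induction T with
  | leaf => rfl
  | node l r ihl ihr =>
    change Fintype.card (Option (l.Caret ⊕ r.Caret)) + 1 = l.leaves + r.leaves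
    rw [Fintype.card_option, Fintype.card_sum]
    omega

theorem length_innerArcs (T : BTree) (p : Fin T.leaves → Bool → E) (q : T.Caret → Corner → E) :
    (T.innerArcs p q).length + 3 = 3 * T.leaves := by
  induction T with
  | leaf => rfl
  | node l r ihl ihr =>
    have h1 := ihl (fun v => p (leftLeaf l r v)) (fun x => q (leftCaret l r x))
    have h2 := ihr (fun v => p (rightLeaf l r v)) (fun x => q (rightCaret l r x))
    simp only [innerArcs, leaves, List.length_cons, List.length_append]
    omega

theorem mem_semiLink (T : BTree) (p : Fin T.leaves → Bool → E) (q : T.Caret → Corner → E) :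
    (∀ v b, p v b ∈ (T.semiLink p q).flatMap fun a => [a.1, a.2]) ∧
      (∀ x k, q x k ∈ (T.semiLink p q).flatMap fun a => [a.1, a.2]) := by
  induction T with
  | leaf =>
    refine ⟨fun v b => ?_, fun x => Empty.elim x⟩
    have : v = (leaf).first := Subsingleton.elim (α := Fin 1) _ _
    subst this
    cases b
    · simp [semiLink]
    · simp [semiLink, top, innerArcs, first]
  | node l r ihl ihr =>
    obtain ⟨hl1, hl2⟩ := ihl (fun v => p (leftLeaf l r v)) (fun x => q (leftCaret l r x))
    obtain ⟨hr1, hr2⟩ := ihr (fun v => p (rightLeaf l r v)) (fun x => q (rightCaret l r x))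
    have hL : ∀ e, e ∈ (l.semiLink (fun v => p (leftLeaf l r v))
        (fun x => q (leftCaret l r x))).flatMap (fun a => [a.1, a.2]) →
        e ∈ ((node l r).semiLink p q).flatMap fun a => [a.1, a.2] := by
      intro e he
      simp only [semiLink, innerArcs, first, List.flatMap_cons, List.flatMap_append,
        List.mem_append, List.mem_cons] at he ⊢
      tauto
    have hR : ∀ e, e ∈ (r.semiLink (fun v => p (rightLeaf l r v))
        (fun x => q (rightCaret l r x))).flatMap (fun a => [a.1, a.2]) →
        e ∈ ((node l r).semiLink p q).flatMap fun a => [a.1, a.2] := by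
      intro e he
      simp only [semiLink, innerArcs, first, List.flatMap_cons, List.flatMap_append,
        List.mem_append, List.mem_cons] at he ⊢
      tauto
    refine ⟨fun v b => ?_, fun x k => ?_⟩
    · induction v using leaf_cases with
      | left j => exact hL _ (hl1 j b)
      | right j => exact hR _ (hr1 j b)
    · match x with
      | none =>
        change q (rootCaret l r) k ∈ _
        cases k <;> simp [semiLink, innerArcs, top]
      | some (Sum.inl x) => exact hL _ (hl2 x k)
      | some (Sum.inr x) => exact hR _ (hr2 x k)

theorem orient_semiLink (T : BTree) (p : Fin T.leaves → Bool → E) (q : T.Caret → Corner → E)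
    (inw : E → Bool) (c : Fin T.leaves → Bool)
    (hc : ∀ x, c (T.edge x).1 ≠ c (T.edge x).2)
    (hl : ∀ v, inw (p v false) = c v) (hr : ∀ v, inw (p v true) = !c v)
    (h1 : ∀ x, inw (q x Corner.outerLeft) = !c (T.edge x).1)
    (h2 : ∀ x, inw (q x Corner.innerLeft) = c (T.edge x).1)
    (h3 : ∀ x, inw (q x Corner.innerRight) = c (T.edge x).1)
    (h4 : ∀ x, inw (q x Corner.outerRight) = !c (T.edge x).1) :
    ∀ a ∈ T.semiLink p q, inw a.1 = !inw a.2 := by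
  suffices h : inw (T.top p q) = !c T.first ∧ ∀ a ∈ T.innerArcs p q, inw a.1 = !inw a.2 by
    intro a ha
    rcases List.mem_cons.1 ha with rfl | ha
    · simp [hl, h.1]
    · exact h.2 a ha
  induction T with
  | leaf => exact ⟨hr _, by simp [innerArcs]⟩
  | node l r ihl ihr =>
    obtain ⟨a1, a2⟩ := ihl (fun v => p (leftLeaf l r v)) (fun x => q (leftCaret l r x))
      (fun v => c (leftLeaf l r v)) (fun x => hc (leftCaret l r x))
      (fun v => hl _) (fun v => hr _) (fun x => h1 (leftCaret l r x))
      (fun x => h2 (leftCaret l r x)) (fun x => h3 (leftCaret l r x))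
      (fun x => h4 (leftCaret l r x))
    obtain ⟨b1, b2⟩ := ihr (fun v => p (rightLeaf l r v)) (fun x => q (rightCaret l r x))
      (fun v => c (rightLeaf l r v)) (fun x => hc (rightCaret l r x))
      (fun v => hl _) (fun v => hr _) (fun x => h1 (rightCaret l r x))
      (fun x => h2 (rightCaret l r x)) (fun x => h3 (rightCaret l r x))
      (fun x => h4 (rightCaret l r x))
    have h0 : c (leftLeaf l r l.first) ≠ c (rightLeaf l r r.first) := hc (rootCaret l r)
    have e2 : inw (q (rootCaret _ _) Corner.innerLeft) = c (leftLeaf l r l.first) := h2 (rootCaret l r)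
    have e3 : inw (q (rootCaret _ _) Corner.innerRight) = c (leftLeaf l r l.first) := h3 (rootCaret l r)
    have e4 : inw (q (rootCaret _ _) Corner.outerRight) = !c (leftLeaf l r l.first) := h4 (rootCaret l r)
    refine ⟨h1 (rootCaret l r), ?_⟩
    intro a ha
    simp only [innerArcs, List.mem_cons, List.mem_append] at ha
    rcases ha with rfl | rfl | rfl | ha | ha
    · simp only [a1, e2]
    · simp only [hl, e3]
      revert h0
      cases c (leftLeaf l r l.first) <;> cases c (rightLeaf l r r.first) <;> simp
    · simp only [b1, e4]
      revert h0
      cases c (leftLeaf l r l.first) <;> cases c (rightLeaf l r r.first) <;> simp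
    · exact a2 a ha
    · exact b2 a ha

end BTree

/-- Crossings on the edges in the upper half plane. In the order south-east, north-east,
north-west, south-west the ends are `0, 1, 2, 3`, so that the over-strand runs from south-west to
north-east. -/
def upperPort : Corner → Fin 4
  | Corner.innerRight => 0
  | Corner.outerRight => 1
  | Corner.outerLeft => 2
  | Corner.innerLeft => 3

/-- Crossings on the edges in the lower half plane. In the order south-west, south-east,
north-east, north-west the ends are `0, 1, 2, 3`, so that the over-strand runs from south-east to
north-west: the other type of crossing. -/
def lowerPort : Corner → Fin 4
  | Corner.outerLeft => 0
  | Corner.outerRight => 1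
  | Corner.innerRight => 2
  | Corner.innerLeft => 3

namespace TreePair

/-- The crossings of `L(T₊, T₋)`: one for each edge of `Γ(T₊, T₋)`. -/
abbrev Cross (D : TreePair) : Type := D.up.Caret ⊕ D.down.Caret

/-- The points in which `L(T₊, T₋)` meets the horizontal axis: `(v, false)` to the left and
`(v, true)` to the right of the vertex `v`. -/
abbrev Pt (D : TreePair) : Type := Fin D.size × Bool

/-- The end, in the upper half plane, of the point `(v, s)`. -/
def upperPoint (D : TreePair) (v : Fin D.up.leaves) (s : Bool) : Ends D.Cross D.Pt :=
  Sum.inr ((v, s), true)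

/-- The end, in the lower half plane, of the point `(v, s)`. -/
def lowerPoint (D : TreePair) (v : Fin D.down.leaves) (s : Bool) : Ends D.Cross D.Pt :=
  Sum.inr ((Fin.cast D.same.symm v, s), false)

/-- The ends at the crossings in the upper half plane. -/
def upperCorner (D : TreePair) (x : D.up.Caret) (k : Corner) : Ends D.Cross D.Pt :=
  Sum.inl (Sum.inl x, upperPort k)

/-- The ends at the crossings in the lower half plane. -/
def lowerCorner (D : TreePair) (x : D.down.Caret) (k : Corner) : Ends D.Cross D.Pt :=
  Sum.inl (Sum.inr x, lowerPort k)

/-- The arcs of `L(T₊, T₋)`: those of the upper and those of the lower semi-link. -/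
def arcs (D : TreePair) : List (Ends D.Cross D.Pt × Ends D.Cross D.Pt) :=
  D.up.semiLink D.upperPoint D.upperCorner ++ D.down.semiLink D.lowerPoint D.lowerCorner

theorem mem_arcs (D : TreePair) (e : Ends D.Cross D.Pt) :
    e ∈ D.arcs.flatMap fun a => [a.1, a.2] := by
  obtain ⟨hu1, hu2⟩ := D.up.mem_semiLink D.upperPoint D.upperCorner
  obtain ⟨hd1, hd2⟩ := D.down.mem_semiLink D.lowerPoint D.lowerCorner
  rw [arcs, List.flatMap_append, List.mem_append]
  rcases e with ⟨x | x, i⟩ | ⟨⟨v, s⟩, b⟩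
  · obtain ⟨k, rfl⟩ : ∃ k, upperPort k = i := by
      fin_cases i
      exacts [⟨Corner.innerRight, rfl⟩, ⟨Corner.outerRight, rfl⟩, ⟨Corner.outerLeft, rfl⟩,
        ⟨Corner.innerLeft, rfl⟩]
    exact Or.inl (hu2 x k)
  · obtain ⟨k, rfl⟩ : ∃ k, lowerPort k = i := by
      fin_cases i
      exacts [⟨Corner.outerLeft, rfl⟩, ⟨Corner.outerRight, rfl⟩, ⟨Corner.innerRight, rfl⟩,
        ⟨Corner.innerLeft, rfl⟩]
    exact Or.inr (hd2 x k)
  · cases b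
    · exact Or.inr (hd1 (Fin.cast D.same v) s)
    · exact Or.inl (hu1 v s)

theorem length_arcs (D : TreePair) :
    (D.arcs.flatMap fun a => [a.1, a.2]).length = Fintype.card (Ends D.Cross D.Pt) := by
  have h : ∀ l : List (Ends D.Cross D.Pt × Ends D.Cross D.Pt),
      (l.flatMap fun a => [a.1, a.2]).length = 2 * l.length := by
    intro l
    induction l with
    | nil => rfl
    | cons a l ih => simp only [List.flatMap_cons, List.length_append, ih]; simp; ring
  have h1 := D.up.length_innerArcs D.upperPoint D.upperCorner
  have h2 := D.down.length_innerArcs D.lowerPoint D.lowerCorner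
  have h3 := D.up.card_caret
  have h4 := D.down.card_caret
  have h5 := D.same
  rw [h]
  simp only [arcs, BTree.semiLink, List.length_append, List.length_cons, Fintype.card_sum,
    Fintype.card_prod, Fintype.card_fin, Fintype.card_bool, size]
  omega

/-- The link diagram `L(T₊, T₋)`: the medial graph of the plane graph `Γ(T₊, T₋)`, with
crossings of one type on the edges coming from `T₊` and of the other type on those coming
from `T₋`. -/
def diagram (D : TreePair) : LinkDiagram where
  Crossing := D.Cross
  Point := D.Pt
  fintypeCrossing := inferInstance
  decEqCrossing := inferInstance
  arcs := D.arcs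
  nodup := by
    classical
    have h : (D.arcs.flatMap fun a => [a.1, a.2]).toFinset = Finset.univ := by
      ext e
      simpa using D.mem_arcs e
    exact Multiset.toFinset_card_eq_card_iff_nodup.1 ((congrArg Finset.card h).trans D.length_arcs.symm)
  mem_ends := D.mem_arcs

/-- The directions of the strands of `L(T₊, T₋)` at all ends, for a colouring of `Γ(T₊, T₋)`: the
boundary of the black region of a vertex is oriented counterclockwise if the vertex has the colour
`true` (the colour `+`) and clockwise if it has the colour `false`. -/
def inward (D : TreePair) (c : Fin D.size → Bool) : Ends D.Cross D.Pt → Bool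
  | Sum.inl (Sum.inl x, i) => decide (i = 0 ∨ i = 3) == c (D.upEdge x).1
  | Sum.inl (Sum.inr x, i) => decide (i = 0 ∨ i = 1) == c (D.downEdge x).1
  | Sum.inr ((v, s), b) => (!s == b) == c v

/-- The orientation of `L(T₊, T₋)`, as the boundary of its Seifert surface, given by a
2-colouring of `Γ(T₊, T₋)`. -/
def orientation (D : TreePair) (c : D.graph.Coloring Bool) : D.diagram.Orientation where
  inward := D.inward c
  through_crossing := by
    rintro (x | x) i <;> fin_cases i <;> simp [inward]
  through_point := by
    rintro ⟨v, s⟩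
    cases s <;> simp [inward]
  along_arc := by
    intro a ha
    rcases List.mem_append.1 ha with ha | ha
    · refine D.up.orient_semiLink _ _ (D.inward c) c (fun x => c.valid (D.adj_up x))
        ?_ ?_ ?_ ?_ ?_ ?_ a ha
      all_goals
        intro v
        simp [inward, upperPoint, upperCorner, upperPort, upEdge]
    · refine D.down.orient_semiLink _ _ (D.inward c) (fun v => !c (Fin.cast D.same.symm v))
        (fun x h => c.valid (D.adj_down x) (Bool.not_inj h)) ?_ ?_ ?_ ?_ ?_ ?_ a ha
      all_goals
        intro v
        simp [inward, lowerPoint, lowerCorner, lowerPort, downEdge]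

/-- The renormalized Jones polynomial of the oriented link given by `(T₊, T₋)` and a colouring,
`V(t) (-t^{-1/2} - t^{1/2})^{-n+1}`, evaluated at `t^{-1/4} = A`. -/
def normalizedJones (D : TreePair) (c : D.graph.Coloring Bool) (A : ℂ) : ℂ :=
  D.diagram.jones (D.orientation c) A * (-A ^ 2 - A⁻¹ ^ 2) ^ (-(D.size : ℤ) + 1)

end TreePair

/-! ### The Jones function -/

/-- Every element of the Jones–Thompson group is represented by a pair of trees with a
2-colouring of `Γ` for which the leftmost vertex has the colour `+`. -/
theorem exists_colored (g : orientedF) :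
    ∃ (D : TreePair) (c : D.graph.Coloring Bool), D.Represents g.1.1 ∧ c D.first = true := by
  obtain ⟨D, hD, hc⟩ := g.2
  have hne : Nonempty (D.graph.Coloring Bool) := by
    by_contra hne
    rw [not_nonempty_iff] at hne
    simp at hc
  obtain ⟨c⟩ := hne
  by_cases h : c D.first = true
  · exact ⟨D, c, hD, h⟩
  · refine ⟨D, SimpleGraph.Coloring.mk (fun v => !c v)
      (fun hvw hh => c.valid hvw (Bool.not_inj hh)), hD, ?_⟩
    change (!c D.first) = true
    simpa using h

/-- The Jones function `g ↦ V_g(t)` on the Jones–Thompson group, computed from some pair of trees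
representing `g` (with its canonical colouring) and the principal value of `t^{-1/4}`. -/
def jonesFunction (t : ℂ) (g : orientedF) : ℂ :=
  (exists_colored g).choose.normalizedJones (exists_colored g).choose_spec.choose
    (t ^ (-(1 / 4) : ℂ))

/-- A complex function on a group is of positive type if all matrices `(φ(gᵢ gⱼ⁻¹))` are
positive semi-definite. -/
def IsPositiveType {G : Type*} [Group G] (φ : G → ℂ) : Prop :=
  ∀ (r : ℕ) (g : Fin r → G), (Matrix.of fun i j => φ (g i * (g j)⁻¹)).PosSemidef

end JonesThompson

end

/-!
The Kauffman bracket of the medial graph `L(T₊, T₋)` is a Potts partition function on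
`Γ(T₊, T₋)`. With `A = t^{-1/4}` and the loop value `δ = -A² - A⁻²` one has
`δ² = t + t⁻¹ + 2`, and at the four values of `t` this is an integer `Q ∈ {4, 2, 3}`. Hence the
states of the bracket can be replaced by assignments of `Q` spins to the vertices of `Γ`.

A state is the same as a set `B` of edges of `Γ`, along which the black regions are joined. The curves
of the smoothed diagram bound a planar surface, so Euler's formula gives
`loops + n = 2 · components B + |B|` (`TreePair.loops_stateOf`). Planarity enters in an indirect way.
Adding an edge to `B` never increases the deviation from this formula
(`TreePair.eulerDefect_insert_le`): a change of one smoothing creates at most one curve, and it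
merges two curves if the edge joins different components, by the parity argument of
`LinkDiagram.mk_joinedOff_stateEnd`. The deviation is at most zero for the empty set, where each curve
goes around one vertex, and at least zero for the set of all edges, where the curves are separated
by the faces of `Γ`; so it vanishes for all `B`.

The writhe is zero because there are as many upper as lower crossings, and the expansion of the
Potts partition function over sets of edges gives
`V_g(t) = Q⁻ⁿ ∑_σ Z_t(T₊, σ) Z_{t⁻¹}(T₋, σ)`
(`TreePair.normalizedJones_eq_partition`), where `Z_w(T, σ)` is the product, over the carets of `T`,
of `-w` if the spins at the two ends of the edge agree and of `1` otherwise. Only `t` enters, not its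
fourth root. Attaching opposite carets adds a vertex tied to one neighbour by an upper and a lower
edge, and the sum over its spin is `Q`, which the normalization cancels; therefore the value depends
only on `g` (`TreePair.Represents.partition_eq`).

Since `|t| = 1`, the weight `Z_{t⁻¹}` is the complex conjugate of `Z_t`. If `g₁, …, g_r` are represented
with a common lower tree, then `gᵢ gⱼ⁻¹` is represented by their upper trees `Tᵢ` and `Tⱼ`, so that the
matrix of the `V_{gᵢ gⱼ⁻¹}(t)` is a positive multiple of the Gram matrix of the vectors
`σ ↦ Z_t(Tᵢ, σ)`.
-/

namespace JonesThompson

noncomputable section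

/-! ### Counting the classes of a quotient -/

theorem card_quot_le {E : Type*} [Finite E] {r r' : E → E → Prop}
    (h : ∀ u v, r u v → Quot.mk r' u = Quot.mk r' v) :
    Nat.card (Quot r') ≤ Nat.card (Quot r) := by
  refine Nat.card_le_card_of_surjective (Quot.lift (Quot.mk r') h) ?_
  rintro ⟨u⟩
  exact ⟨Quot.mk r u, rfl⟩

/-- Adding one pair to a relation merges at most two classes. -/
theorem card_quot_le_add_one {E : Type*} [Finite E] {r r' : E → E → Prop} (a b : E)
    (h : ∀ u v, r' u v → r u v ∨ (u = a ∧ v = b)) :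
    Nat.card (Quot r) ≤ Nat.card (Quot r') + 1 := by
  classical
  have hf : ∀ u v, r' u v →
      (if Quot.mk r u = Quot.mk r b then Quot.mk r a else Quot.mk r u) =
        if Quot.mk r v = Quot.mk r b then Quot.mk r a else Quot.mk r v := by
    intro u v huv
    rcases h u v huv with h1 | ⟨rfl, rfl⟩
    · rw [Quot.sound h1]
    · simp
  rw [← Finite.card_option]
  refine Nat.card_le_card_of_surjective
    (fun o : Option (Quot r') => o.elim (Quot.mk r b) (Quot.lift _ hf)) ?_
  rintro ⟨u⟩
  by_cases hu : Quot.mk r u = Quot.mk r b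
  · exact ⟨none, hu.symm⟩
  · exact ⟨some (Quot.mk r' u), if_neg hu⟩

theorem card_quot_lt {E : Type*} [Finite E] {r r' : E → E → Prop} (a b : E)
    (h : ∀ u v, r u v → Quot.mk r' u = Quot.mk r' v)
    (hne : Quot.mk r a ≠ Quot.mk r b) (heq : Quot.mk r' a = Quot.mk r' b) :
    Nat.card (Quot r') < Nat.card (Quot r) := by
  have hs : Function.Surjective (Quot.lift (Quot.mk r') h) := by
    rintro ⟨u⟩
    exact ⟨Quot.mk r u, rfl⟩
  refine lt_of_le_of_ne (card_quot_le h) fun hc => hne ?_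
  exact (hs.bijective_of_nat_card_le hc.ge).1 heq

namespace LinkDiagram

/-! ### Changing one smoothing of a link diagram -/

variable (L : LinkDiagram)

instance finite_point : Finite L.Point := by
  have h : (Set.univ : Set (Ends L.Crossing L.Point)).Finite :=
    (List.finite_toSet _).subset fun e _ => L.mem_ends e
  have : Finite (Ends L.Crossing L.Point) := Set.finite_univ_iff.1 h
  exact Finite.of_injective (fun p => (Sum.inr (p, true) : Ends L.Crossing L.Point))
    fun p q h => by simpa using h

variable {L}

theorem eq_of_joined {X : Type*} {s : L.Crossing → Bool} (f : Ends L.Crossing L.Point → X)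
    (harc : ∀ a ∈ L.arcs, f a.1 = f a.2)
    (hpoint : ∀ p, f (Sum.inr (p, true)) = f (Sum.inr (p, false)))
    (hA : ∀ x, s x = true → f (Sum.inl (x, 0)) = f (Sum.inl (x, 1)) ∧
      f (Sum.inl (x, 2)) = f (Sum.inl (x, 3)))
    (hB : ∀ x, s x = false → f (Sum.inl (x, 1)) = f (Sum.inl (x, 2)) ∧
      f (Sum.inl (x, 3)) = f (Sum.inl (x, 0)))
    {u v : Ends L.Crossing L.Point} (h : L.Joined s u v) : f u = f v := by
  cases h with
  | arc a ha => exact harc a ha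
  | point p => exact hpoint p
  | smoothA₁ x hx => exact (hA x hx).1
  | smoothA₂ x hx => exact (hA x hx).2
  | smoothB₁ x hx => exact (hB x hx).1
  | smoothB₂ x hx => exact (hB x hx).2

/-- The state `s` with the smoothing at the crossing `x` changed. -/
def toggle (s : L.Crossing → Bool) (x : L.Crossing) : L.Crossing → Bool :=
  Function.update s x (!s x)

/-- The identifications of ends that do not come from the smoothing at `x`; its connected
components are those of the diagram smoothed everywhere but at `x`, where the four ends are
left open. -/
def JoinedOff (s : L.Crossing → Bool) (x : L.Crossing) (u v : Ends L.Crossing L.Point) : Prop :=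
  L.Joined s u v ∧ L.Joined (toggle s x) u v

/-- The ends at the crossing `x`, numbered so that the smoothing `s x` connects `0` to `1` and `2`
to `3`, and the other smoothing connects `1` to `2` and `3` to `0`. -/
def stateEnd (s : L.Crossing → Bool) (x : L.Crossing) (i : Fin 4) : Ends L.Crossing L.Point :=
  Sum.inl (x, if s x then i else i + 1)

/-- The two identifications at `x` are the only ones that are not common to both smoothings. -/
theorem joined_cases {s : L.Crossing → Bool} (x : L.Crossing) {u v : Ends L.Crossing L.Point}
    (h : L.Joined s u v) :
    JoinedOff s x u v ∨ (u = stateEnd s x 0 ∧ v = stateEnd s x 1) ∨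
      (u = stateEnd s x 2 ∧ v = stateEnd s x 3) := by
  cases h with
  | arc a ha => exact Or.inl ⟨.arc a ha, .arc a ha⟩
  | point p => exact Or.inl ⟨.point p, .point p⟩
  | smoothA₁ y hy =>
    by_cases hxy : y = x
    · subst hxy; simp [stateEnd, hy]
    · exact Or.inl ⟨.smoothA₁ y hy, .smoothA₁ y (by simp [toggle, hxy, hy])⟩
  | smoothA₂ y hy =>
    by_cases hxy : y = x
    · subst hxy; simp [stateEnd, hy]
    · exact Or.inl ⟨.smoothA₂ y hy, .smoothA₂ y (by simp [toggle, hxy, hy])⟩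
  | smoothB₁ y hy =>
    by_cases hxy : y = x
    · subst hxy; simp [stateEnd, hy]
    · exact Or.inl ⟨.smoothB₁ y hy, .smoothB₁ y (by simp [toggle, hxy, hy])⟩
  | smoothB₂ y hy =>
    by_cases hxy : y = x
    · subst hxy; simp [stateEnd, hy]
    · exact Or.inl ⟨.smoothB₂ y hy, .smoothB₂ y (by simp [toggle, hxy, hy])⟩

theorem joined_stateEnd (s : L.Crossing → Bool) (x : L.Crossing) :
    Quot.mk (L.Joined s) (stateEnd s x 0) = Quot.mk _ (stateEnd s x 1) ∧
      Quot.mk (L.Joined s) (stateEnd s x 2) = Quot.mk _ (stateEnd s x 3) := by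
  cases hs : s x
  · simp only [stateEnd, hs]
    exact ⟨Quot.sound (.smoothB₁ x hs), Quot.sound (.smoothB₂ x hs)⟩
  · simp only [stateEnd, hs]
    exact ⟨Quot.sound (.smoothA₁ x hs), Quot.sound (.smoothA₂ x hs)⟩

theorem joined_toggle_stateEnd (s : L.Crossing → Bool) (x : L.Crossing) :
    Quot.mk (L.Joined (toggle s x)) (stateEnd s x 1) = Quot.mk _ (stateEnd s x 2) ∧
      Quot.mk (L.Joined (toggle s x)) (stateEnd s x 3) = Quot.mk _ (stateEnd s x 0) := by
  have h := joined_stateEnd (toggle s x) x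
  cases hs : s x
  · simp only [stateEnd, toggle, hs, Function.update_self] at h ⊢
    exact ⟨h.2, h.1⟩
  · simp only [stateEnd, toggle, hs, Function.update_self] at h ⊢
    exact h

theorem mk_joined_of_off {s : L.Crossing → Bool} {x : L.Crossing} {u v : Ends L.Crossing L.Point}
    (h : Quot.mk (JoinedOff s x) u = Quot.mk _ v) :
    Quot.mk (L.Joined s) u = Quot.mk _ v ∧ Quot.mk (L.Joined (toggle s x)) u = Quot.mk _ v :=
  ⟨congrArg (Quot.lift (Quot.mk (L.Joined s)) fun _ _ h => Quot.sound h.1) h,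
    congrArg (Quot.lift (Quot.mk (L.Joined (toggle s x))) fun _ _ h => Quot.sound h.2) h⟩

/-- The arcs pair the ends, so a function modulo `2` that is constant along arcs has sum zero. -/
theorem sum_ends_eq_zero (f : Ends L.Crossing L.Point → ZMod 2) [Fintype L.Point]
    (hf : ∀ a ∈ L.arcs, f a.1 = f a.2) : ∑ e, f e = 0 := by
  classical
  have h1 : (L.arcs.flatMap fun a => [a.1, a.2]).toFinset = Finset.univ := by
    ext e
    simpa using L.mem_ends e
  rw [← h1, List.sum_toFinset _ L.nodup]
  have h2 : ∀ l : List (Ends L.Crossing L.Point × Ends L.Crossing L.Point),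
      (∀ a ∈ l, f a.1 = f a.2) → ((l.flatMap fun a => [a.1, a.2]).map f).sum = 0 := by
    intro l hl
    induction l with
    | nil => rfl
    | cons a l ih =>
      have := ih fun b hb => hl b (List.mem_cons_of_mem _ hb)
      simp [hl a List.mem_cons_self, this, CharTwo.add_self_eq_zero]
  exact h2 _ hf

/-- If the two strands of the smoothing `s x` lie on different curves, then each of these curves is
closed up outside of `x`: a path that leaves `x` comes back to `x`, and it can only come back at the
other end of the same strand. The proof is a parity argument. The arcs pair all ends of a component
off `x`, and the marked points and the other smoothings pair all of them except those at `x`. -/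
theorem mk_joinedOff_stateEnd {s : L.Crossing → Bool} {x : L.Crossing}
    (h : Quot.mk (L.Joined s) (stateEnd s x 0) ≠ Quot.mk _ (stateEnd s x 2)) :
    Quot.mk (JoinedOff s x) (stateEnd s x 0) = Quot.mk _ (stateEnd s x 1) := by
  classical
  by_contra hne
  have := Fintype.ofFinite L.Point
  let f : Ends L.Crossing L.Point → ZMod 2 := fun u =>
    if Quot.mk (JoinedOff s x) u = Quot.mk _ (stateEnd s x 0) then 1 else 0
  have hoff : ∀ u v, JoinedOff s x u v → f u = f v := fun u v huv => by
    simp only [f, Quot.sound huv]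
  have hsum := sum_ends_eq_zero f fun a ha => hoff _ _ ⟨.arc a ha, .arc a ha⟩
  have hf0 : f (stateEnd s x 0) = 1 := if_pos rfl
  have hf1 : f (stateEnd s x 1) = 0 := if_neg fun h1 => hne h1.symm
  have hf2 : f (stateEnd s x 2) = 0 := if_neg fun h1 => h (mk_joined_of_off h1).1.symm
  have hf3 : f (stateEnd s x 3) = 0 := if_neg fun h1 => h
    (((joined_stateEnd s x).2.trans (mk_joined_of_off h1).1).symm)
  have hpoint : ∀ p : L.Point, ∑ b : Bool, f (Sum.inr (p, b)) = 0 := by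
    intro p
    rw [Fintype.sum_bool, hoff _ _ ⟨.point p, .point p⟩, CharTwo.add_self_eq_zero]
  have hother : ∀ y, y ≠ x → ∑ i : Fin 4, f (Sum.inl (y, i)) = 0 := by
    intro y hy
    have hty : toggle s x y = s y := by simp [toggle, hy]
    rw [Fin.sum_univ_four]
    cases hs : s y
    · rw [hoff _ _ ⟨.smoothB₁ y hs, .smoothB₁ y (hty.trans hs)⟩,
        hoff _ _ ⟨.smoothB₂ y hs, .smoothB₂ y (hty.trans hs)⟩]
      linear_combination (f (Sum.inl (y, 0)) + f (Sum.inl (y, 2))) *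
        (CharTwo.two_eq_zero (R := ZMod 2))
    · rw [hoff _ _ ⟨.smoothA₁ y hs, .smoothA₁ y (hty.trans hs)⟩,
        hoff _ _ ⟨.smoothA₂ y hs, .smoothA₂ y (hty.trans hs)⟩]
      linear_combination (f (Sum.inl (y, 1)) + f (Sum.inl (y, 3))) *
        (CharTwo.two_eq_zero (R := ZMod 2))
  have hself : ∑ i : Fin 4, f (Sum.inl (x, i)) = 1 := by
    have : ∑ i : Fin 4, f (stateEnd s x i) = 1 := by
      rw [Fin.sum_univ_four, hf0, hf1, hf2, hf3]
      rfl
    rw [← this]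
    cases hs : s x
    · simp only [stateEnd, hs]
      exact (Equiv.sum_comp (Equiv.addRight (1 : Fin 4)) fun i => f (Sum.inl (x, i))).symm
    · simp [stateEnd, hs]
  rw [Fintype.sum_sum_type, Fintype.sum_prod_type, Fintype.sum_prod_type,
    Finset.sum_eq_single x (fun y _ hy => hother y hy) (by simp), hself,
    Finset.sum_eq_zero fun p _ => hpoint p] at hsum
  simp at hsum

/-- Connecting all four ends at `x` merges at most two curves of the new state. The result has at most
as many components as the old state, because it contains all identifications of the old state. -/
theorem loops_toggle_le (s : L.Crossing → Bool) (x : L.Crossing) :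
    L.loops (toggle s x) ≤ L.loops s + 1 := by
  refine (card_quot_le_add_one (r' := fun u v => L.Joined (toggle s x) u v ∨
    (u = stateEnd s x 0 ∧ v = stateEnd s x 1)) _ _ fun _ _ h => h).trans
    (Nat.add_le_add_right (card_quot_le ?_) 1)
  intro u v huv
  have hmono : ∀ {u v}, Quot.mk (L.Joined (toggle s x)) u = Quot.mk _ v →
      Quot.mk (fun u v => L.Joined (toggle s x) u v ∨
        (u = stateEnd s x 0 ∧ v = stateEnd s x 1)) u = Quot.mk _ v := fun h =>
    congrArg (Quot.lift (Quot.mk _) fun _ _ h => Quot.sound (Or.inl h)) h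
  have h01 : Quot.mk (fun u v => L.Joined (toggle s x) u v ∨
        (u = stateEnd s x 0 ∧ v = stateEnd s x 1)) (stateEnd s x 0) = Quot.mk _ (stateEnd s x 1) :=
    Quot.sound (Or.inr ⟨rfl, rfl⟩)
  obtain ⟨h12, h30⟩ := joined_toggle_stateEnd s x
  rcases joined_cases x huv with h | ⟨rfl, rfl⟩ | ⟨rfl, rfl⟩
  · exact Quot.sound (Or.inl h.2)
  · exact h01
  · exact (hmono h12).symm.trans (h01.symm.trans (hmono h30).symm)

/-- Changing the smoothing at a crossing where two different curves meet merges them. -/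
theorem loops_toggle_lt {s : L.Crossing → Bool} {x : L.Crossing}
    (h : Quot.mk (L.Joined s) (stateEnd s x 0) ≠ Quot.mk _ (stateEnd s x 2)) :
    L.loops (toggle s x) < L.loops s := by
  have h01 := (mk_joined_of_off (mk_joinedOff_stateEnd h)).2
  obtain ⟨h12, h30⟩ := joined_toggle_stateEnd s x
  refine card_quot_lt _ _ ?_ h (h01.trans h12)
  intro u v huv
  rcases joined_cases x huv with h | ⟨rfl, rfl⟩ | ⟨rfl, rfl⟩
  · exact Quot.sound h.2
  · exact h01
  · exact h12.symm.trans (h01.symm.trans h30.symm)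

end LinkDiagram

namespace BTree

/-! ### Invariants of the arcs of a semi-link -/

variable {E : Type}

/-- The arcs run along the boundaries of the black regions: a label of the ends by the vertices
to whose regions they belong is constant along the arcs. -/
theorem vertex_semiLink {V : Type*} (T : BTree) (p : Fin T.leaves → Bool → E)
    (q : T.Caret → Corner → E) (f : E → V) (c : Fin T.leaves → V)
    (hp : ∀ v b, f (p v b) = c v)
    (h1 : ∀ x, f (q x Corner.outerLeft) = c (T.edge x).1)
    (h2 : ∀ x, f (q x Corner.innerLeft) = c (T.edge x).1)
    (h3 : ∀ x, f (q x Corner.innerRight) = c (T.edge x).2)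
    (h4 : ∀ x, f (q x Corner.outerRight) = c (T.edge x).2) :
    ∀ a ∈ T.semiLink p q, f a.1 = f a.2 := by
  suffices h : f (T.top p q) = c T.first ∧ ∀ a ∈ T.innerArcs p q, f a.1 = f a.2 by
    intro a ha
    rcases List.mem_cons.1 ha with rfl | ha
    · exact (hp _ _).trans h.1.symm
    · exact h.2 a ha
  induction T with
  | leaf => exact ⟨hp _ _, by simp [innerArcs]⟩
  | node l r ihl ihr =>
    obtain ⟨a1, a2⟩ := ihl (fun v => p (leftLeaf l r v)) (fun x => q (leftCaret l r x))
      (fun v => c (leftLeaf l r v)) (fun v => hp _) (fun x => h1 (leftCaret l r x))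
      (fun x => h2 (leftCaret l r x)) (fun x => h3 (leftCaret l r x))
      (fun x => h4 (leftCaret l r x))
    obtain ⟨b1, b2⟩ := ihr (fun v => p (rightLeaf l r v)) (fun x => q (rightCaret l r x))
      (fun v => c (rightLeaf l r v)) (fun v => hp _) (fun x => h1 (rightCaret l r x))
      (fun x => h2 (rightCaret l r x)) (fun x => h3 (rightCaret l r x))
      (fun x => h4 (rightCaret l r x))
    refine ⟨h1 (rootCaret l r), ?_⟩
    intro a ha
    simp only [innerArcs, List.mem_cons, List.mem_append] at ha
    rcases ha with rfl | rfl | rfl | ha | ha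
    · exact a1.trans (h2 (rootCaret l r)).symm
    · exact (hp _ _).trans (h3 (rootCaret l r)).symm
    · exact b1.trans (h4 (rootCaret l r)).symm
    · exact a2 a ha
    · exact b2 a ha

/-- The last leaf below a caret. -/
def lastBelow : (T : BTree) → T.Caret → ℕ
  | leaf, x => Empty.elim x
  | node l r, none => l.leaves + r.leaves - 1
  | node l _, some (Sum.inl x) => l.lastBelow x
  | node l r, some (Sum.inr x) => l.leaves + r.lastBelow x

theorem leaves_pos (T : BTree) : 0 < T.leaves := by
  induction T with
  | leaf => exact Nat.one_pos
  | node l r ihl _ => exact Nat.add_pos_left ihl _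

theorem val_first (T : BTree) : (T.first : ℕ) = 0 := by
  induction T with
  | leaf => rfl
  | node l r ihl _ => simpa [first, leftLeaf] using ihl

theorem edge_snd_pos (T : BTree) (x : T.Caret) : 0 < ((T.edge x).2 : ℕ) := by
  induction T with
  | leaf => exact Empty.elim x
  | node l r ihl ihr =>
    match x with
    | none => simpa [edge, rightLeaf, val_first] using l.leaves_pos
    | some (Sum.inl x) => simpa [edge, leftLeaf] using ihl x
    | some (Sum.inr x) => simp [edge, rightLeaf, ihr x]

/-- The gap to the left of the leaf `v` lies in the face labelled `v - 1`, the gap to the right of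
`v` in the face labelled `v`. The inner and the outer side of an edge belong to the faces that
end just before its right endpoint and with the last leaf below its caret. This labelling of the
white regions is constant along the arcs. -/
theorem face_semiLink (T : BTree) (p : Fin T.leaves → Bool → E) (q : T.Caret → Corner → E)
    (f : E → ℕ) (h0 : f (p T.first false) = T.leaves - 1)
    (hl : ∀ v, v ≠ T.first → f (p v false) + 1 = v) (hr : ∀ v, f (p v true) = v)
    (h1 : ∀ x, f (q x Corner.outerLeft) = T.lastBelow x)
    (h2 : ∀ x, f (q x Corner.innerLeft) + 1 = (T.edge x).2)
    (h3 : ∀ x, f (q x Corner.innerRight) + 1 = (T.edge x).2)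
    (h4 : ∀ x, f (q x Corner.outerRight) = T.lastBelow x) :
    ∀ a ∈ T.semiLink p q, f a.1 = f a.2 := by
  suffices h : ∀ o : ℕ, (∀ v, v ≠ T.first → f (p v false) + 1 = o + v) →
      (∀ v, f (p v true) = o + v) → (∀ x, f (q x Corner.outerLeft) = o + T.lastBelow x) →
      (∀ x, f (q x Corner.innerLeft) + 1 = o + (T.edge x).2) →
      (∀ x, f (q x Corner.innerRight) + 1 = o + (T.edge x).2) →
      (∀ x, f (q x Corner.outerRight) = o + T.lastBelow x) →
      f (T.top p q) + 1 = o + T.leaves ∧ ∀ a ∈ T.innerArcs p q, f a.1 = f a.2 by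
    obtain ⟨ht, hi⟩ := h 0 (by simpa using hl) (by simpa using hr) (by simpa using h1)
      (by simpa using h2) (by simpa using h3) (by simpa using h4)
    intro a ha
    rcases List.mem_cons.1 ha with rfl | ha
    · simp only
      omega
    · exact hi a ha
  clear h0 hl hr h1 h2 h3 h4
  induction T with
  | leaf =>
    intro o _ hr _ _ _ _
    refine ⟨?_, by simp [innerArcs]⟩
    have := hr (0 : Fin 1)
    simp only [top, leaves]
    rw [this]
    rfl
  | node l r ihl ihr =>
    intro o hl hr h1 h2 h3 h4
    obtain ⟨a1, a2⟩ := ihl (fun v => p (leftLeaf l r v)) (fun x => q (leftCaret l r x)) o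
      (fun v hv => hl (leftLeaf l r v) fun h => hv (Fin.castAdd_injective _ _ h))
      (fun v => hr _) (fun x => h1 (leftCaret l r x))
      (fun x => h2 (leftCaret l r x)) (fun x => h3 (leftCaret l r x))
      (fun x => h4 (leftCaret l r x))
    have hpos := l.leaves_pos
    have hne : ∀ v, rightLeaf l r v ≠ (node l r).first := by
      intro v h
      have := congrArg Fin.val h
      rw [val_first] at this
      simp only [rightLeaf, Fin.val_natAdd] at this
      omega
    obtain ⟨b1, b2⟩ := ihr (fun v => p (rightLeaf l r v)) (fun x => q (rightCaret l r x))
      (o + l.leaves)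
      (fun v _ => (hl (rightLeaf l r v) (hne v)).trans (Nat.add_assoc _ _ _).symm)
      (fun v => (hr (rightLeaf l r v)).trans (Nat.add_assoc _ _ _).symm)
      (fun x => (h1 (rightCaret l r x)).trans (Nat.add_assoc _ _ _).symm)
      (fun x => (h2 (rightCaret l r x)).trans (Nat.add_assoc _ _ _).symm)
      (fun x => (h3 (rightCaret l r x)).trans (Nat.add_assoc _ _ _).symm)
      (fun x => (h4 (rightCaret l r x)).trans (Nat.add_assoc _ _ _).symm)
    have e1 : f (q (rootCaret l r) Corner.outerLeft) = o + (l.leaves + r.leaves - 1) :=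
      h1 (rootCaret l r)
    have e2 : f (q (rootCaret l r) Corner.innerLeft) + 1 = o + (l.leaves + (r.first : ℕ)) :=
      h2 (rootCaret l r)
    have e3 : f (q (rootCaret l r) Corner.innerRight) + 1 = o + (l.leaves + (r.first : ℕ)) :=
      h3 (rootCaret l r)
    have e4 : f (q (rootCaret l r) Corner.outerRight) = o + (l.leaves + r.leaves - 1) :=
      h4 (rootCaret l r)
    have e5 : f (p (rightLeaf l r r.first) false) + 1 = o + (l.leaves + (r.first : ℕ)) :=
      hl _ (hne _)
    rw [val_first] at e2 e3 e5
    refine ⟨?_, ?_⟩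
    · simp only [top, leaves]
      omega
    intro a ha
    simp only [innerArcs, List.mem_cons, List.mem_append] at ha
    rcases ha with rfl | rfl | rfl | ha | ha
    · simp only
      omega
    · simp only
      omega
    · simp only
      omega
    · exact a2 a ha
    · exact b2 a ha

/-- If at each crossing the smoothing separates the two endpoints of the edge, then every curve of
the smoothed semi-link lies around one vertex. -/
theorem isolated_semiLink {X : Type*} (T : BTree) (p : Fin T.leaves → Bool → E)
    (q : T.Caret → Corner → E) (f : E → X) (hf : ∀ a ∈ T.semiLink p q, f a.1 = f a.2)
    (hl : ∀ x, f (q x Corner.outerLeft) = f (q x Corner.innerLeft))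
    (hr : ∀ x, f (q x Corner.outerRight) = f (q x Corner.innerRight)) :
    (∀ v, f (p v false) = f (p v true)) ∧ ∀ x k, ∃ v, f (q x k) = f (p v true) := by
  induction T with
  | leaf =>
    refine ⟨fun v => ?_, fun x => Empty.elim x⟩
    have : v = (leaf).first := Subsingleton.elim (α := Fin 1) _ _
    subst this
    exact hf _ List.mem_cons_self
  | node l r ihl ihr =>
    have t0 : f (p (node l r).first false) = f (q (rootCaret l r) Corner.outerLeft) :=
      hf _ List.mem_cons_self
    simp only [semiLink, innerArcs, List.mem_cons, List.mem_append, or_imp,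
      forall_and] at hf
    obtain ⟨-, h1, h2, h3, t4, t5⟩ := hf
    have t1 := h1 _ rfl
    have t2 := h2 _ rfl
    have t3 := h3 _ rfl
    obtain ⟨l1, l2⟩ := ihl (fun v => p (leftLeaf l r v)) (fun x => q (leftCaret l r x))
      (List.forall_mem_cons.2 ⟨t0.trans ((hl (rootCaret l r)).trans t1.symm), t4⟩)
      (fun x => hl (leftCaret l r x)) (fun x => hr (leftCaret l r x))
    obtain ⟨r1, r2⟩ := ihr (fun v => p (rightLeaf l r v)) (fun x => q (rightCaret l r x))
      (List.forall_mem_cons.2 ⟨t2.trans ((hr (rootCaret l r)).symm.trans t3.symm), t5⟩)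
      (fun x => hl (rightCaret l r x)) (fun x => hr (rightCaret l r x))
    refine ⟨fun v => ?_, fun x k => ?_⟩
    · induction v using leaf_cases with
      | left j => exact l1 j
      | right j => exact r1 j
    · match x with
      | none =>
        have hL : f (q (rootCaret l r) Corner.outerLeft) = f (p (node l r).first true) :=
          t0.symm.trans (l1 l.first)
        have hR : f (q (rootCaret l r) Corner.innerRight) = f (p (rightLeaf l r r.first) true) :=
          t2.symm.trans (r1 r.first)
        cases k
        · exact ⟨_, hL⟩
        · exact ⟨_, (hl (rootCaret l r)).symm.trans hL⟩
        · exact ⟨_, hR⟩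
        · exact ⟨_, (hr (rootCaret l r)).trans hR⟩
      | some (Sum.inl x) =>
        obtain ⟨v, hv⟩ := l2 x k
        exact ⟨leftLeaf l r v, hv⟩
      | some (Sum.inr x) =>
        obtain ⟨v, hv⟩ := r2 x k
        exact ⟨rightLeaf l r v, hv⟩

/-- The half `Γ`-graph of a tree is connected. -/
theorem eq_first_of_edge {X : Type*} (T : BTree) (f : Fin T.leaves → X)
    (hf : ∀ x, f (T.edge x).1 = f (T.edge x).2) (v : Fin T.leaves) : f v = f T.first := by
  induction T with
  | leaf => exact congrArg f (Subsingleton.elim (α := Fin 1) _ _)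
  | node l r ihl ihr =>
    have hl := ihl (fun j => f (leftLeaf l r j)) (fun x => hf (leftCaret l r x))
    have hr := ihr (fun j => f (rightLeaf l r j)) (fun x => hf (rightCaret l r x))
    induction v using leaf_cases with
    | left j => exact hl j
    | right j => exact (hr j).trans (hf (rootCaret l r)).symm

end BTree

namespace TreePair

/-! ### The number of curves in a smoothing of `L(T₊, T₋)` -/

variable (D : TreePair)

/-- The edges of `Γ(T₊, T₋)`, as pairs (left endpoint, right endpoint). -/
def edge : D.Cross → Fin D.size × Fin D.size := Sum.elim D.upEdge D.downEdge

/-- The state in which the two black regions at a crossing are joined if its edge belongs to `B`,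
and separated otherwise. Because of the two types of crossings, they are joined by the
`A⁻¹`-smoothing on the upper edges and by the `A`-smoothing on the lower edges. -/
def stateOf (B : Finset D.Cross) : D.diagram.Crossing → Bool
  | Sum.inl x => decide (Sum.inl x ∉ B)
  | Sum.inr x => decide (Sum.inr x ∈ B)

/-- Two vertices are bonded if they are joined by an edge in `B`. -/
def Bond (B : Finset D.Cross) (i j : Fin D.size) : Prop := ∃ e ∈ B, D.edge e = (i, j)

/-- The number of connected components of the spanning subgraph of `Γ(T₊, T₋)` with edges `B`. -/
def components (B : Finset D.Cross) : ℕ := Nat.card (Quot (D.Bond B))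

/-- The vertex whose black region has the given end on its boundary. -/
def vertexOf : Ends D.Cross D.Pt → Fin D.size
  | Sum.inl (Sum.inl x, i) => if i = 0 ∨ i = 1 then (D.upEdge x).2 else (D.upEdge x).1
  | Sum.inl (Sum.inr x, i) => if i = 1 ∨ i = 2 then (D.downEdge x).2 else (D.downEdge x).1
  | Sum.inr ((v, _), _) => v

/-- The label, as in `BTree.face_semiLink`, of the face to which an end is adjacent when all black
regions are joined. The outer face contains the gaps to the left of the first and to the right of the
last vertex, so both have the label `n - 1`. -/
def faceOf : Ends D.Cross D.Pt → ℕ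
  | Sum.inl (Sum.inl x, i) =>
    if i = 0 ∨ i = 3 then (D.up.edge x).2 - 1 else D.up.lastBelow x
  | Sum.inl (Sum.inr x, i) =>
    if i = 2 ∨ i = 3 then (D.down.edge x).2 - 1 else D.down.lastBelow x
  | Sum.inr ((v, true), _) => v
  | Sum.inr ((v, false), _) => if v = D.first then D.size - 1 else v - 1

theorem vertexOf_arc : ∀ a ∈ D.arcs, D.vertexOf a.1 = D.vertexOf a.2 := by
  intro a ha
  rcases List.mem_append.1 ha with ha | ha
  · exact D.up.vertex_semiLink _ _ D.vertexOf id (fun _ _ => rfl) (fun _ => rfl) (fun _ => rfl)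
      (fun _ => rfl) (fun _ => rfl) a ha
  · exact D.down.vertex_semiLink _ _ D.vertexOf (Fin.cast D.same.symm) (fun _ _ => rfl)
      (fun _ => rfl) (fun _ => rfl) (fun _ => rfl) (fun _ => rfl) a ha

theorem faceOf_arc : ∀ a ∈ D.arcs, D.faceOf a.1 = D.faceOf a.2 := by
  intro a ha
  rcases List.mem_append.1 ha with ha | ha
  · refine D.up.face_semiLink D.upperPoint D.upperCorner D.faceOf (if_pos rfl)
      (fun v hv => ?_) (fun _ => rfl) (fun _ => rfl) (fun x => ?_) (fun x => ?_) (fun _ => rfl) a ha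
    · have : (v : ℕ) ≠ 0 := fun h => hv (Fin.ext (h.trans D.up.val_first.symm))
      rw [show D.faceOf (D.upperPoint v false) = v - 1 from if_neg hv]
      omega
    all_goals exact Nat.sub_add_cancel (D.up.edge_snd_pos x)
  · have h0 : Fin.cast D.same.symm D.down.first = D.first := BTree.cast_first D.same.symm
    refine D.down.face_semiLink D.lowerPoint D.lowerCorner D.faceOf
      ((if_pos h0).trans (congrArg (· - 1) D.same)) (fun v hv => ?_) (fun _ => rfl)
      (fun _ => rfl) (fun x => ?_) (fun x => ?_) (fun _ => rfl) a ha
    · have : (v : ℕ) ≠ 0 := fun h => hv (Fin.ext (h.trans D.down.val_first.symm))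
      have h1 : D.faceOf (D.lowerPoint v false) = v - 1 :=
        if_neg fun h => hv (Fin.cast_injective _ (h.trans h0.symm))
      rw [h1]
      omega
    all_goals exact Nat.sub_add_cancel (D.down.edge_snd_pos x)

theorem toggle_stateOf {B : Finset D.Cross} {e : D.Cross} (he : e ∉ B) :
    LinkDiagram.toggle (D.stateOf B) e = D.stateOf (insert e B) := by
  funext y
  by_cases h : y = e
  · subst h
    refine (Function.update_self _ _ _).trans ?_
    rcases y with y | y <;> simp [stateOf, he]
  · have h' : LinkDiagram.toggle (D.stateOf B) e y = D.stateOf B y := Function.update_of_ne h _ _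
    rw [h']
    rcases y with y | y
    · have : (Sum.inl y : D.Cross) ∈ insert e B ↔ Sum.inl y ∈ B := by
        simp only [Finset.mem_insert, or_iff_right_iff_imp]; exact fun h1 => absurd h1 h
      simp [stateOf, this]
    · have : (Sum.inr y : D.Cross) ∈ insert e B ↔ Sum.inr y ∈ B := by
        simp only [Finset.mem_insert, or_iff_right_iff_imp]; exact fun h1 => absurd h1 h
      simp [stateOf, this]

/-- A curve of the smoothed diagram stays in one component of the black regions. -/
theorem bond_of_joined {B : Finset D.Cross} {u v : Ends D.Cross D.Pt}
    (h : D.diagram.Joined (D.stateOf B) u v) :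
    Quot.mk (D.Bond B) (D.vertexOf u) = Quot.mk _ (D.vertexOf v) := by
  refine LinkDiagram.eq_of_joined (L := D.diagram) (fun u => Quot.mk (D.Bond B) (D.vertexOf u))
    (fun a ha => congrArg _ (D.vertexOf_arc a ha)) (fun _ => rfl) ?_ ?_ h
  · rintro (x | x) hx
    · exact ⟨rfl, rfl⟩
    · have h1 : D.Bond B (D.downEdge x).1 (D.downEdge x).2 :=
        ⟨Sum.inr x, by simpa [stateOf] using hx, rfl⟩
      exact ⟨Quot.sound h1, (Quot.sound h1).symm⟩
  · rintro (x | x) hx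
    · have h1 : D.Bond B (D.upEdge x).1 (D.upEdge x).2 :=
        ⟨Sum.inl x, by simpa [stateOf] using hx, rfl⟩
      exact ⟨(Quot.sound h1).symm, Quot.sound h1⟩
    · exact ⟨rfl, rfl⟩

/-- The deviation from Euler's formula for the surface that is formed by the black regions, joined
along the edges in `B`, and whose boundary is the smoothed diagram. -/
def eulerDefect (B : Finset D.Cross) : ℤ :=
  D.diagram.loops (D.stateOf B) + D.size - 2 * D.components B - B.card

/-- If the edge `e` joins different components, then `components` drops by one and two curves merge;
otherwise `components` stays, and at most one curve is added. -/
theorem eulerDefect_insert_le {B : Finset D.Cross} {e : D.Cross} (he : e ∉ B) :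
    D.eulerDefect (insert e B) ≤ D.eulerDefect B := by
  have hcases : ∀ u v, D.Bond (insert e B) u v →
      D.Bond B u v ∨ (u = (D.edge e).1 ∧ v = (D.edge e).2) := by
    rintro u v ⟨y, hy, huv⟩
    rcases Finset.mem_insert.1 hy with rfl | hy
    · right; simp [huv]
    · exact Or.inl ⟨y, hy, huv⟩
  unfold eulerDefect
  rw [Finset.card_insert_of_notMem he, ← D.toggle_stateOf he]
  by_cases hc : Quot.mk (D.Bond B) (D.edge e).1 = Quot.mk _ (D.edge e).2
  · have h1 := LinkDiagram.loops_toggle_le (D.stateOf B) e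
    have h2 : D.components B ≤ D.components (insert e B) := by
      refine card_quot_le fun u v huv => ?_
      rcases hcases u v huv with h | ⟨rfl, rfl⟩
      · exact Quot.sound h
      · exact hc
    push_cast
    omega
  · have h1 : D.diagram.loops (LinkDiagram.toggle (D.stateOf B) e) <
        D.diagram.loops (D.stateOf B) := by
      refine LinkDiagram.loops_toggle_lt fun h => hc ?_
      have h3 := congrArg (Quot.lift (fun u => Quot.mk (D.Bond B) (D.vertexOf u))
        fun _ _ h => D.bond_of_joined h) h
      rcases e with x | x
      · have hs : D.stateOf B (Sum.inl x) = true := by simpa [stateOf] using he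
        simp only [LinkDiagram.stateEnd, hs] at h3
        exact h3.symm
      · have hs : D.stateOf B (Sum.inr x) = false := by simpa [stateOf] using he
        simp only [LinkDiagram.stateEnd, hs] at h3
        exact h3.symm
    have h2 : D.components B ≤ D.components (insert e B) + 1 := card_quot_le_add_one _ _ hcases
    push_cast
    omega

theorem eulerDefect_anti {B C : Finset D.Cross} (h : B ⊆ C) :
    D.eulerDefect C ≤ D.eulerDefect B := by
  have hC : ∀ S : Finset D.Cross, Disjoint S B → D.eulerDefect (S ∪ B) ≤ D.eulerDefect B := by
    intro S
    induction S using Finset.induction_on with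
    | empty => simp
    | insert e S he ih =>
      intro hd
      rw [Finset.disjoint_insert_left] at hd
      rw [Finset.insert_union]
      exact (D.eulerDefect_insert_le (by simp [he, hd.1])).trans (ih hd.2)
  have := hC (C \ B) Finset.sdiff_disjoint
  rwa [Finset.sdiff_union_of_subset h] at this

theorem eulerDefect_empty : D.eulerDefect ∅ ≤ 0 := by
  have h1 : D.components ∅ = D.size := by
    have hb : Function.Bijective (Quot.mk (D.Bond ∅)) := by
      refine ⟨fun u v h => ?_, Quot.mk_surjective⟩
      exact congrArg (Quot.lift id fun _ _ ⟨_, h, _⟩ => absurd h (Finset.notMem_empty _)) h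
    rw [components, ← Nat.card_congr (Equiv.ofBijective _ hb), Nat.card_fin]
  have h2 : D.diagram.loops (D.stateOf ∅) ≤ D.size := by
    let f : Ends D.Cross D.Pt → Quot (D.diagram.Joined (D.stateOf ∅)) := Quot.mk _
    have hup : ∀ x, D.stateOf ∅ (Sum.inl x) = true := fun x => by simp [stateOf]
    have hdown : ∀ x, D.stateOf ∅ (Sum.inr x) = false := fun x => by simp [stateOf]
    have harc : ∀ a ∈ D.arcs, f a.1 = f a.2 := fun a ha =>
      Quot.sound (LinkDiagram.Joined.arc (L := D.diagram) a ha)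
    obtain ⟨u1, u2⟩ := D.up.isolated_semiLink D.upperPoint D.upperCorner f
      (fun a ha => harc a (List.mem_append_left _ ha))
      (fun x => Quot.sound (LinkDiagram.Joined.smoothA₂ (L := D.diagram) (Sum.inl x) (hup x)))
      (fun x => (Quot.sound (LinkDiagram.Joined.smoothA₁ (L := D.diagram) (Sum.inl x) (hup x))).symm)
    obtain ⟨d1, d2⟩ := D.down.isolated_semiLink D.lowerPoint D.lowerCorner f
      (fun a ha => harc a (List.mem_append_right _ ha))
      (fun x => (Quot.sound (LinkDiagram.Joined.smoothB₂ (L := D.diagram) (Sum.inr x) (hdown x))).symm)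
      (fun x => Quot.sound (LinkDiagram.Joined.smoothB₁ (L := D.diagram) (Sum.inr x) (hdown x)))
    have hpt : ∀ p : D.Pt, f (Sum.inr (p, true)) = f (Sum.inr (p, false)) :=
      fun p =>
      Quot.sound (LinkDiagram.Joined.point (L := D.diagram) p)
    have hs : Function.Surjective fun v : Fin D.size => f (D.upperPoint v true) := by
      rintro ⟨⟨x | x, i⟩ | ⟨⟨v, s⟩, b⟩⟩
      · obtain ⟨k, rfl⟩ : ∃ k, upperPort k = i := by
          fin_cases i
          exacts [⟨Corner.innerRight, rfl⟩, ⟨Corner.outerRight, rfl⟩, ⟨Corner.outerLeft, rfl⟩,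
            ⟨Corner.innerLeft, rfl⟩]
        obtain ⟨v, hv⟩ := u2 x k
        exact ⟨v, hv.symm⟩
      · obtain ⟨k, rfl⟩ : ∃ k, lowerPort k = i := by
          fin_cases i
          exacts [⟨Corner.outerLeft, rfl⟩, ⟨Corner.outerRight, rfl⟩, ⟨Corner.innerRight, rfl⟩,
            ⟨Corner.innerLeft, rfl⟩]
        obtain ⟨v, hv⟩ := d2 x k
        exact ⟨Fin.cast D.same.symm v, (hpt _).trans hv.symm⟩
      · refine ⟨v, ?_⟩
        have h3 : f (Sum.inr ((v, s), true)) = f (Sum.inr ((v, s), b)) := by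
          cases b
          · exact hpt _
          · rfl
        refine Eq.trans ?_ h3
        cases s
        · exact (u1 v).symm
        · rfl
    have := Nat.card_le_card_of_surjective _ hs
    rwa [Nat.card_fin] at this
  rw [eulerDefect, h1, Finset.card_empty]
  push_cast
  omega

theorem card_cross : Fintype.card D.Cross + 2 = 2 * D.size := by
  have h1 := D.up.card_caret
  have h2 := D.down.card_caret
  have h3 := D.same
  rw [Fintype.card_sum]
  simp only [size]
  omega

theorem le_eulerDefect_univ : 0 ≤ D.eulerDefect Finset.univ := by
  have h1 : D.components Finset.univ ≤ 1 := by
    have : Subsingleton (Quot (D.Bond Finset.univ)) := by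
      have h := D.up.eq_first_of_edge (Quot.mk (D.Bond Finset.univ))
        fun x => Quot.sound ⟨Sum.inl x, Finset.mem_univ _, rfl⟩
      refine ⟨?_⟩
      rintro ⟨u⟩ ⟨v⟩
      exact (h u).trans (h v).symm
    exact Finite.card_le_one_iff_subsingleton.2 this
  have h2 : D.size ≤ D.diagram.loops (D.stateOf Finset.univ) := by
    have hj : ∀ u v, D.diagram.Joined (D.stateOf Finset.univ) u v → D.faceOf u = D.faceOf v := by
      intro u v
      refine LinkDiagram.eq_of_joined (L := D.diagram) D.faceOf D.faceOf_arc ?_ ?_ ?_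
      · rintro ⟨v, s⟩
        cases s <;> rfl
      · rintro (x | x) hx
        · simp [stateOf] at hx
        · exact ⟨rfl, rfl⟩
      · rintro (x | x) hx
        · exact ⟨rfl, rfl⟩
        · simp [stateOf] at hx
    have hi : Function.Injective fun v : Fin D.size =>
        Quot.mk (D.diagram.Joined (D.stateOf Finset.univ)) (D.upperPoint v true) :=
      fun u v h => Fin.ext (congrArg (Quot.lift D.faceOf hj) h)
    have := Nat.card_le_card_of_injective _ hi
    rwa [Nat.card_fin] at this
  have h3 := D.card_cross
  rw [eulerDefect, Finset.card_univ]
  omega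

/-- Euler's formula for the smoothings of `L(T₊, T₋)`. The deviation can only decrease when edges
are added, it is not positive without edges, and it is not negative with all edges. -/
theorem loops_stateOf (B : Finset D.Cross) :
    D.diagram.loops (D.stateOf B) + D.size = 2 * D.components B + B.card := by
  have h1 := D.eulerDefect_anti (Finset.empty_subset B)
  have h2 := D.eulerDefect_anti (Finset.subset_univ B)
  have h3 := D.eulerDefect_empty
  have h4 := D.le_eulerDefect_univ
  have h5 : D.eulerDefect B = 0 := by omega
  rw [eulerDefect] at h5
  omega

end TreePair

/-! ### The Jones polynomial as a Potts partition function -/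

/-- The Potts weight of an edge whose endpoints carry the spins `a` and `b`. -/
def bondWeight {S : Type*} [DecidableEq S] (w : ℂ) (a b : S) : ℂ := if a = b then -w else 1

/-- The Potts weight of the half `Γ`-graph of a tree whose leaves carry the spins
`σ 0, σ 1, …`. -/
def BTree.pottsWeight {S : Type*} [DecidableEq S] (w : ℂ) : BTree → (ℕ → S) → ℂ
  | .leaf, _ => 1
  | .node l r, σ => bondWeight w (σ 0) (σ l.leaves) *
      (l.pottsWeight w σ * r.pottsWeight w fun j => σ (l.leaves + j))

theorem BTree.pottsWeight_eq_prod {S : Type*} [DecidableEq S] (w : ℂ) (T : BTree) (σ : ℕ → S) :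
    T.pottsWeight w σ = ∏ x, bondWeight w (σ (T.edge x).1) (σ (T.edge x).2) := by
  induction T generalizing σ with
  | leaf => exact (Fintype.prod_empty (ι := Empty) _).symm
  | node l r ihl ihr =>
    refine Eq.trans ?_ (Fintype.prod_option (α := l.Caret ⊕ r.Caret) _).symm
    rw [Fintype.prod_sum_type, pottsWeight, ihl, ihr]
    simp [edge, leftLeaf, rightLeaf, val_first]

/-- A finite configuration of spins, continued by an arbitrary constant. -/
def extend {S : Type*} [Inhabited S] {n : ℕ} (σ : Fin n → S) (j : ℕ) : S :=
  if h : j < n then σ ⟨j, h⟩ else default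

theorem extend_val {S : Type*} [Inhabited S] {n : ℕ} (σ : Fin n → S) (j : Fin n) :
    extend σ j = σ j := dif_pos j.2

/-- The number of spin configurations that are constant on the components of a graph. -/
theorem sum_bonds {V X S : Type*} [Fintype V] [DecidableEq V] [Fintype S] [DecidableEq S]
    (B : Finset X) (e : X → V × V) :
    ∑ σ : V → S, ∏ x ∈ B, (if σ (e x).1 = σ (e x).2 then (1 : ℂ) else 0) =
      (Fintype.card S : ℂ) ^ Nat.card (Quot fun i j => ∃ x ∈ B, e x = (i, j)) := by
  classical
  let E : {σ : V → S // ∀ x ∈ B, σ (e x).1 = σ (e x).2} ≃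
      (Quot (fun i j => ∃ x ∈ B, e x = (i, j)) → S) :=
    { toFun := fun σ => Quot.lift σ.1 (by
        rintro i j ⟨x, hx, h⟩
        simpa [h] using σ.2 x hx)
      invFun := fun τ => ⟨fun v => τ (Quot.mk _ v), fun x hx =>
        congrArg τ (Quot.sound ⟨x, hx, rfl⟩)⟩
      left_inv := fun σ => rfl
      right_inv := fun τ => by
        funext q
        induction q using Quot.ind
        rfl }
  simp_rw [Finset.prod_boole]
  rw [Finset.sum_boole, ← Fintype.card_subtype, ← Nat.card_eq_fintype_card, Nat.card_congr E,
    Nat.card_fun, Nat.card_eq_fintype_card]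
  push_cast
  rfl

namespace TreePair

variable (D : TreePair)

/-- The normalized partition function of the Potts model on `Γ(T₊, T₋)` with spins in `S`. -/
def partition (S : Type*) [Fintype S] [DecidableEq S] [Inhabited S] (w : ℂ) : ℂ :=
  ((Fintype.card S : ℂ) ^ D.size)⁻¹ * ∑ σ : Fin D.size → S,
    D.up.pottsWeight w (extend σ) * D.down.pottsWeight w⁻¹ (extend σ)

theorem writhe_orientation (c : D.graph.Coloring Bool) :
    LinkDiagram.writhe (D.orientation c) = 0 := by
  have hup : ∀ x, LinkDiagram.crossingSign (D.orientation c) (Sum.inl x) = 1 := by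
    intro x
    simp [LinkDiagram.crossingSign, orientation, inward]
  have hdown : ∀ x, LinkDiagram.crossingSign (D.orientation c) (Sum.inr x) = -1 := by
    intro x
    simp [LinkDiagram.crossingSign, orientation, inward]
  have h1 := D.up.card_caret
  have h2 := D.down.card_caret
  have h3 := D.same
  refine (Fintype.sum_sum_type (α₁ := D.up.Caret) (α₂ := D.down.Caret) _).trans ?_
  simp only [hup, hdown, Finset.sum_const, Finset.card_univ, nsmul_eq_mul]
  omega

theorem stateOf_bijective : Function.Bijective D.stateOf := by
  refine ⟨fun B C h => ?_, fun s => ?_⟩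
  · ext x
    have hx := congrFun h x
    rcases x with x | x <;> simpa [stateOf, not_iff_not] using hx
  · classical
    refine ⟨Finset.univ.filter fun x : D.Cross =>
      s x = Sum.elim (fun _ => false) (fun _ => true) x, ?_⟩
    funext x
    rcases x with x | x
    · cases hs : s (Sum.inl x) <;> simp [stateOf, hs]
    · cases hs : s (Sum.inr x) <;> simp [stateOf, hs]

/-- The Kauffman weight of the smoothing that joins the black regions at a crossing. -/
def joinWeight (A : ℂ) : D.Cross → ℂ := Sum.elim (fun _ => A⁻¹) fun _ => A

theorem prod_stateOf (A : ℂ) (B : Finset D.Cross) :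
    ∏ x, (if D.stateOf B x then A else A⁻¹) =
      (∏ x ∈ B, D.joinWeight A x) * ∏ x ∈ Bᶜ, (D.joinWeight A x)⁻¹ := by
  refine (Finset.prod_mul_prod_compl B fun x : D.Cross =>
    if D.stateOf B x then A else A⁻¹).symm.trans ?_
  congr 1
  · refine Finset.prod_congr rfl fun x hx => ?_
    rcases x with x | x <;> simp [stateOf, joinWeight, hx]
  · refine Finset.prod_congr rfl fun x hx => ?_
    rw [Finset.mem_compl] at hx
    rcases x with x | x <;> simp [stateOf, joinWeight, hx]

theorem prod_joinWeight {A : ℂ} (hA : A ≠ 0) : ∏ x, (D.joinWeight A x)⁻¹ = 1 := by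
  have h1 := D.up.card_caret
  have h2 := D.down.card_caret
  have h3 := D.same
  have h4 : Fintype.card D.up.Caret = Fintype.card D.down.Caret := by omega
  rw [Fintype.prod_sum_type]
  simp only [joinWeight, Sum.elim_inl, Sum.elim_inr, Finset.prod_const, Finset.card_univ, h4]
  rw [← mul_pow, inv_inv, mul_inv_cancel₀ hA, one_pow]

/-- The Fortuin–Kasteleyn expansion: summing over the spins each term of the expanded product of
the edge weights gives a power of the number of spins, and by Euler's formula this is the power of
the loop value `δ` in the Kauffman bracket. -/
theorem normalizedJones_eq_partition (S : Type*) [Fintype S] [DecidableEq S] [Inhabited S]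
    (c : D.graph.Coloring Bool) {A t : ℂ} (hA : A ≠ 0) (ht : A ^ (-4 : ℤ) = t)
    (hS : (Fintype.card S : ℂ) = t + t⁻¹ + 2) :
    D.normalizedJones c A = D.partition S t := by
  have hcard : (Fintype.card S : ℂ) ≠ 0 := Nat.cast_ne_zero.2 Fintype.card_ne_zero
  have hA4 : t⁻¹ = A ^ 4 := by rw [← ht, zpow_neg, inv_inv]; norm_cast
  have hA4' : t = (A⁻¹) ^ 4 := by rw [← inv_inv t, hA4, inv_pow]
  set δ : ℂ := -A ^ 2 - A⁻¹ ^ 2 with hδ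
  have hAA : A * A⁻¹ = 1 := mul_inv_cancel₀ hA
  have hδQ : δ ^ 2 = Fintype.card S := by
    rw [hS, hA4, hA4', hδ]
    linear_combination 2 * (A * A⁻¹ + 1) * hAA
  have hδ0 : δ ≠ 0 := fun h => hcard (by rw [← hδQ, h]; simp)
  have hbond : ∀ (x : D.Cross) (σ : Fin D.size → S),
      D.joinWeight A x * δ * (if σ (D.edge x).1 = σ (D.edge x).2 then 1 else 0) +
        (D.joinWeight A x)⁻¹ = (D.joinWeight A x)⁻¹ * Sum.elim
          (fun y => bondWeight t (σ (D.upEdge y).1) (σ (D.upEdge y).2))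
          (fun y => bondWeight t⁻¹ (σ (D.downEdge y).1) (σ (D.downEdge y).2)) x := by
    intro x σ
    by_cases h : σ (D.edge x).1 = σ (D.edge x).2
    · rw [if_pos h]
      rcases x with x | x
      · have h1 : bondWeight t (σ (D.upEdge x).1) (σ (D.upEdge x).2) = -t := if_pos h
        simp only [joinWeight, Sum.elim_inl, h1, inv_inv]
        rw [hA4', hδ]
        linear_combination (-A + A⁻¹ ^ 3) * hAA
      · have h1 : bondWeight t⁻¹ (σ (D.downEdge x).1) (σ (D.downEdge x).2) = -t⁻¹ := if_pos h
        simp only [joinWeight, Sum.elim_inr, h1]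
        rw [hA4, hδ]
        linear_combination (-A⁻¹ + A ^ 3) * hAA
    · rw [if_neg h, mul_zero, zero_add]
      rcases x with x | x
      · have h1 : bondWeight t (σ (D.upEdge x).1) (σ (D.upEdge x).2) = 1 := if_neg h
        simp only [Sum.elim_inl, h1, mul_one]
      · have h1 : bondWeight t⁻¹ (σ (D.downEdge x).1) (σ (D.downEdge x).2) = 1 := if_neg h
        simp only [Sum.elim_inr, h1, mul_one]
  have hpart : ∀ σ : Fin D.size → S,
      D.up.pottsWeight t (extend σ) * D.down.pottsWeight t⁻¹ (extend σ) =
        ∑ B : Finset D.Cross, (∏ x ∈ B, D.joinWeight A x * δ *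
          (if σ (D.edge x).1 = σ (D.edge x).2 then 1 else 0)) *
            ∏ x ∈ Bᶜ, (D.joinWeight A x)⁻¹ := by
    intro σ
    rw [← Fintype.prod_add]
    simp_rw [hbond]
    rw [Finset.prod_mul_distrib, D.prod_joinWeight hA, one_mul, Fintype.prod_sum_type,
      BTree.pottsWeight_eq_prod, BTree.pottsWeight_eq_prod]
    congr 1
    · simp only [extend_val, Sum.elim_inl]
      rfl
    · refine Finset.prod_congr rfl fun x _ => ?_
      exact congrArg₂ _ (extend_val σ (D.downEdge x).1) (extend_val σ (D.downEdge x).2)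
  have hloops : ∀ B : Finset D.Cross,
      δ ^ (D.diagram.loops (D.stateOf B) - 1) * δ ^ (-(D.size : ℤ) + 1) =
        ((Fintype.card S : ℂ) ^ D.size)⁻¹ * (δ ^ B.card *
          (Fintype.card S : ℂ) ^ D.components B) := by
    intro B
    have h1 := D.loops_stateOf B
    have h2 : 0 < D.diagram.loops (D.stateOf B) := by
      have : Nonempty (Quot (D.diagram.Joined (D.stateOf B))) :=
        ⟨Quot.mk _ (D.upperPoint D.first true)⟩
      exact Nat.card_pos
    rw [← hδQ, ← pow_mul, ← pow_mul, ← zpow_natCast, ← zpow_natCast, ← zpow_natCast,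
      ← zpow_natCast, ← zpow_neg, ← zpow_add₀ hδ0, ← zpow_add₀ hδ0, ← zpow_add₀ hδ0]
    congr 1
    push_cast [Nat.cast_sub h2]
    omega
  rw [normalizedJones, LinkDiagram.jones, D.writhe_orientation, neg_zero, zpow_zero, one_mul,
    LinkDiagram.bracket, partition, ← D.stateOf_bijective.sum_comp, ← hδ, Finset.sum_mul]
  simp_rw [hpart]
  rw [Finset.sum_comm, Finset.mul_sum]
  refine Finset.sum_congr rfl fun B _ => ?_
  rw [mul_assoc, hloops, ← Finset.sum_mul]
  simp_rw [Finset.prod_mul_distrib]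
  rw [← Finset.mul_sum, sum_bonds B D.edge, Finset.prod_const]
  have h1 := D.prod_stateOf A B
  have h2 : Nat.card (Quot fun i j => ∃ x ∈ B, D.edge x = (i, j)) = D.components B := rfl
  rw [h2]
  refine (congrArg (· * _) h1).trans ?_
  ring

end TreePair

namespace BTree

/-! ### Attaching opposite carets -/

/-- The tree obtained by attaching a caret to the leaf `k`. (If there is no such leaf, the caret is
attached to the last leaf.) -/
def expandAt : BTree → ℕ → BTree
  | leaf, _ => node leaf leaf
  | node l r, k =>
    if k < l.leaves then node (l.expandAt k) r else node l (r.expandAt (k - l.leaves))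

theorem Expand.exists_expandAt {T T' : BTree} (h : Expand T T') :
    ∃ k, k < T.leaves ∧ T' = T.expandAt k := by
  induction h with
  | here => exact ⟨0, Nat.one_pos, rfl⟩
  | left r _ ih =>
    obtain ⟨k, hk, rfl⟩ := ih
    exact ⟨k, Nat.lt_add_right _ hk, (if_pos hk).symm⟩
  | @right l r r' _ ih =>
    obtain ⟨k, hk, rfl⟩ := ih
    exact ⟨l.leaves + k, Nat.add_lt_add_left hk _, by simp [expandAt]⟩

theorem leaves_expandAt (T : BTree) (k : ℕ) : (T.expandAt k).leaves = T.leaves + 1 := by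
  induction T generalizing k with
  | leaf => rfl
  | node l r ihl ihr =>
    rw [expandAt]
    split_ifs
    · simp only [leaves, ihl]
      omega
    · simp only [leaves, ihr]
      omega

theorem addresses_expandAt (T : BTree) (k : ℕ) (hk : k < T.leaves) :
    ∃ p u q, p.length = k ∧ T.addresses = p ++ u :: q ∧
      (T.expandAt k).addresses = p ++ (u ++ [false]) :: (u ++ [true]) :: q := by
  induction T generalizing k with
  | leaf => exact ⟨[], [], [], (Nat.lt_one_iff.1 hk).symm, rfl, rfl⟩
  | node l r ihl ihr =>
    rw [expandAt]
    split_ifs with h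
    · obtain ⟨p, u, q, h0, h1, h2⟩ := ihl k h
      exact ⟨p.map (List.cons false), false :: u,
        q.map (List.cons false) ++ r.addresses.map (List.cons true),
        by simp [h0], by simp [addresses, h1], by simp [addresses, h2]⟩
    · simp only [leaves] at hk
      obtain ⟨p, u, q, h0, h1, h2⟩ := ihr (k - l.leaves) (by omega)
      refine ⟨l.addresses.map (List.cons false) ++ p.map (List.cons true), true :: u,
        q.map (List.cons true), ?_, by simp [addresses, h1], by simp [addresses, h2]⟩
      simp only [List.length_append, List.length_map, length_addresses, h0]
      omega

theorem addresses_injective : Function.Injective addresses := by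
  intro T
  induction T with
  | leaf =>
    intro S h
    cases S with
    | leaf => rfl
    | node l r =>
      have := congrArg List.length h
      rw [length_addresses, length_addresses] at this
      have hl := l.leaves_pos
      have hr := r.leaves_pos
      simp only [leaves] at this
      omega
  | node l r ihl ihr =>
    intro S h
    cases S with
    | leaf =>
      have := congrArg List.length h
      rw [length_addresses, length_addresses] at this
      have hl := l.leaves_pos
      have hr := r.leaves_pos
      simp only [leaves] at this
      omega
    | node l' r' =>
      have key : ∀ a b : BTree,
          (node a b).addresses.filterMap
            (fun u => if u.head? = some false then some u.tail else none)
            = a.addresses ∧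
          (node a b).addresses.filterMap
            (fun u => if u.head? = some true then some u.tail else none)
            = b.addresses := by
        intro a b
        simp [addresses, List.filterMap_append, List.filterMap_map, Function.comp_def]
      rw [ihl ((key l r).1.symm.trans ((congrArg _ h).trans (key l' r').1)),
        ihr ((key l r).2.symm.trans ((congrArg _ h).trans (key l' r').2))]

theorem pottsWeight_expandAt {S : Type*} [DecidableEq S] (w : ℂ) (T : BTree) (k : ℕ)
    (hk : k < T.leaves) (σ : ℕ → S) :
    (T.expandAt k).pottsWeight w σ = bondWeight w (σ k) (σ (k + 1)) *
      T.pottsWeight w fun j => σ (if j ≤ k then j else j + 1) := by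
  induction T generalizing k σ with
  | leaf =>
    obtain rfl : k = 0 := Nat.lt_one_iff.1 hk
    simp [expandAt, pottsWeight, leaves]
  | node l r ihl ihr =>
    rw [expandAt]
    split_ifs with h
    · have e : ∀ j, (if l.leaves + j ≤ k then l.leaves + j else l.leaves + j + 1) =
          l.leaves + 1 + j := fun j => by split_ifs <;> omega
      have e0 := e 0
      simp only [add_zero] at e0
      simp only [pottsWeight, ihl k h, leaves_expandAt, e, e0, Nat.zero_le, if_true]
      ring
    · simp only [leaves] at hk
      have e : ∀ j, (if l.leaves + j ≤ k then l.leaves + j else l.leaves + j + 1) =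
          l.leaves + (if j ≤ k - l.leaves then j else j + 1) := fun j => by split_ifs <;> omega
      have e0 := e 0
      simp only [add_zero, Nat.zero_le, if_true] at e0
      have e1 : l.leaves + (k - l.leaves) = k := by omega
      have e2 : l.leaves + (k - l.leaves + 1) = k + 1 := by omega
      have e3 : l.pottsWeight w (fun j => σ (if j ≤ k then j else j + 1)) = l.pottsWeight w σ := by
        rw [pottsWeight_eq_prod, pottsWeight_eq_prod]
        refine Finset.prod_congr rfl fun x _ => ?_
        rw [if_pos (by omega), if_pos (by omega)]
      simp only [pottsWeight, ihr (k - l.leaves) (by omega), e, e0, e1, e2, e3, Nat.zero_le,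
        if_true]
      ring

theorem conj_pottsWeight {S : Type*} [DecidableEq S] {w : ℂ} (hw : star w = w⁻¹) (T : BTree)
    (σ : ℕ → S) : star (T.pottsWeight w σ) = T.pottsWeight w⁻¹ σ := by
  simp only [pottsWeight_eq_prod, star_prod]
  refine Finset.prod_congr rfl fun x _ => ?_
  unfold bondWeight
  split_ifs <;> simp [← hw]

end BTree

theorem sum_bondWeight {S : Type*} [Fintype S] [DecidableEq S] {w : ℂ} (hw : w ≠ 0) (a : S) :
    ∑ b, bondWeight w a b * bondWeight w⁻¹ a b = Fintype.card S := by
  have h : ∀ b, bondWeight w a b * bondWeight w⁻¹ a b = 1 := by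
    intro b
    unfold bondWeight
    split_ifs
    · rw [neg_mul_neg, mul_inv_cancel₀ hw]
    · exact one_mul _
  simp [h]

/-- Summing over the spin at a vertex that is joined only to its left neighbour, by an upper and a
lower edge. -/
theorem sum_extend_succ {S : Type*} [Fintype S] [DecidableEq S] [Inhabited S] {w : ℂ} (hw : w ≠ 0)
    {n m k : ℕ} (hm : m = n + 1) (hk : k < n) (F : (ℕ → S) → ℂ) :
    ∑ σ : Fin m → S, bondWeight w (extend σ k) (extend σ (k + 1)) *
        bondWeight w⁻¹ (extend σ k) (extend σ (k + 1)) *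
          F (fun j => extend σ (if j ≤ k then j else j + 1)) =
      Fintype.card S * ∑ σ : Fin n → S, F (extend σ) := by
  subst hm
  let p : Fin (n + 1) := ⟨k + 1, by omega⟩
  have hskip : ∀ (a : S) (σ : Fin n → S) (j : ℕ),
      extend (p.insertNth (α := fun _ => S) a σ) (if j ≤ k then j else j + 1) = extend σ j := by
    intro a σ j
    by_cases hj : j < n
    · have h1 : (if j ≤ k then j else j + 1) = (p.succAbove ⟨j, hj⟩ : Fin (n + 1)) := by
        simp only [Fin.succAbove, p, Fin.lt_def, Fin.val_castSucc, Nat.lt_succ_iff]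
        split_ifs <;> rfl
      rw [h1, extend_val, Fin.insertNth_apply_succAbove]
      exact (extend_val σ ⟨j, hj⟩).symm
    · have h1 : (if j ≤ k then j else j + 1) = j + 1 := if_neg (by omega)
      rw [h1]
      simp only [extend]
      rw [dif_neg (by omega), dif_neg hj]
  have hk0 : ∀ (a : S) (σ : Fin n → S),
      extend (p.insertNth (α := fun _ => S) a σ) k = extend σ k := by
    intro a σ
    have := hskip a σ k
    rwa [if_pos le_rfl] at this
  have hk1 : ∀ (a : S) (σ : Fin n → S),
      extend (p.insertNth (α := fun _ => S) a σ) (k + 1) = a := by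
    intro a σ
    exact (extend_val _ p).trans (Fin.insertNth_apply_same (α := fun _ => S) p a σ)
  rw [← (Fin.insertNthEquiv (fun _ => S) p).sum_comp, Fintype.sum_prod_type, Finset.sum_comm,
    Finset.mul_sum]
  refine Finset.sum_congr rfl fun σ _ => ?_
  have hterm : ∀ a : S, bondWeight w (extend (Fin.insertNthEquiv (fun _ => S) p (a, σ)) k)
      (extend (Fin.insertNthEquiv (fun _ => S) p (a, σ)) (k + 1)) *
        bondWeight w⁻¹ (extend (Fin.insertNthEquiv (fun _ => S) p (a, σ)) k)
          (extend (Fin.insertNthEquiv (fun _ => S) p (a, σ)) (k + 1)) *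
        F (fun j => extend (Fin.insertNthEquiv (fun _ => S) p (a, σ))
          (if j ≤ k then j else j + 1)) =
      bondWeight w (extend σ k) a * bondWeight w⁻¹ (extend σ k) a * F (extend σ) := by
    intro a
    have h0 := hk0 a σ
    have h1 := hk1 a σ
    have h2 := funext (hskip a σ)
    exact congrArg₂ (· * ·) (congrArg₂ (· * ·) (congrArg₂ _ h0 h1) (congrArg₂ _ h0 h1))
      (congrArg F h2)
  rw [Finset.sum_congr rfl fun a _ => hterm a, ← Finset.sum_mul, sum_bondWeight hw]

namespace TreePair

/-- The pair of trees with carets attached to the leaves `k` of both trees. -/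
def expandAt (D : TreePair) (k : ℕ) : TreePair :=
  ⟨D.up.expandAt k, D.down.expandAt k, by
    rw [BTree.leaves_expandAt, BTree.leaves_expandAt, D.same]⟩

variable {S : Type*} [Fintype S] [DecidableEq S] [Inhabited S]

theorem partition_expandAt (D : TreePair) {k : ℕ} (hk : k < D.size) {w : ℂ} (hw : w ≠ 0) :
    (D.expandAt k).partition S w = D.partition S w := by
  have hcard : (Fintype.card S : ℂ) ≠ 0 := Nat.cast_ne_zero.2 Fintype.card_ne_zero
  have hsize : (D.expandAt k).size = D.size + 1 := BTree.leaves_expandAt _ _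
  have hsum := sum_extend_succ hw hsize hk fun σ : ℕ → S =>
    D.up.pottsWeight w σ * D.down.pottsWeight w⁻¹ σ
  have hterm : ∀ σ : Fin (D.expandAt k).size → S,
      (D.expandAt k).up.pottsWeight w (extend σ) * (D.expandAt k).down.pottsWeight w⁻¹ (extend σ) =
        bondWeight w (extend σ k) (extend σ (k + 1)) *
        bondWeight w⁻¹ (extend σ k) (extend σ (k + 1)) *
          (D.up.pottsWeight w (fun j => extend σ (if j ≤ k then j else j + 1)) *
            D.down.pottsWeight w⁻¹ (fun j => extend σ (if j ≤ k then j else j + 1))) := by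
    intro σ
    have h1 := D.up.pottsWeight_expandAt w k hk (extend σ)
    have h2 := D.down.pottsWeight_expandAt w⁻¹ k (hk.trans_eq D.same) (extend σ)
    refine (congrArg₂ (· * ·) h1 h2).trans ?_
    ring
  rw [partition, Finset.sum_congr rfl fun σ _ => hterm σ, hsum, hsize, partition, pow_succ,
    mul_inv, mul_assoc, inv_mul_cancel_left₀ hcard]

theorem Represents.expandAt {D : TreePair} {g : Equiv.Perm (Stream' Bool)} (h : D.Represents g)
    {k : ℕ} (hk : k < D.size) : (D.expandAt k).Represents g := by
  obtain ⟨p, u, q, h0, h1, h2⟩ := D.up.addresses_expandAt k hk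
  obtain ⟨p', u', q', h0', h1', h2'⟩ := D.down.addresses_expandAt k (hk.trans_eq D.same)
  have h3 : List.Forall₂ (fun u v => ∀ w : Stream' Bool, g (v ++ₛ w) = u ++ₛ w)
    D.up.addresses D.down.addresses := h
  rw [h1, h1'] at h3
  have hp := List.forall₂_take k h3
  have hq := List.forall₂_drop k h3
  rw [← h0, List.take_left, List.take_left' (h0'.trans h0.symm)] at hp
  rw [← h0, List.drop_left, List.drop_left' (h0'.trans h0.symm)] at hq
  obtain ⟨hu, hq⟩ := List.forall₂_cons.1 hq
  change List.Forall₂ _ (D.up.expandAt k).addresses (D.down.expandAt k).addresses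
  rw [h2, h2']
  refine List.rel_append hp (List.Forall₂.cons ?_ (List.Forall₂.cons ?_ hq))
  all_goals
    intro w
    rw [Stream'.append_append_stream, Stream'.append_append_stream]
    exact hu _

theorem Represents.exists_down_eq {D : TreePair} {g : Equiv.Perm (Stream' Bool)}
    (h : D.Represents g) {w : ℂ} (hw : w ≠ 0) {R : BTree} (hR : D.down.Refines R) :
    ∃ D' : TreePair, D'.Represents g ∧ D'.down = R ∧ D'.partition S w = D.partition S w := by
  induction hR with
  | refl => exact ⟨D, h, rfl, rfl⟩
  | tail _ hstep ih =>
    obtain ⟨D', h1, rfl, h3⟩ := ih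
    obtain ⟨k, hk, rfl⟩ := hstep.exists_expandAt
    have hk' := hk.trans_eq D'.same.symm
    exact ⟨D'.expandAt k, h1.expandAt hk', rfl, (D'.partition_expandAt hk' hw).trans h3⟩

/-- A nonempty word `b :: v` cannot be a prefix of every sequence `w`; it fails for the constant
sequence with the other letter. -/
theorem append_stream_injective {u v : List Bool} (h : ∀ w : Stream' Bool, u ++ₛ w = v ++ₛ w) :
    u = v := by
  have hnil : ∀ (b : Bool) (v : List Bool), ¬∀ w : Stream' Bool, w = (b :: v) ++ₛ w := by
    intro b v h
    have := congrArg Stream'.head (h (Stream'.const !b))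
    rw [Stream'.cons_append_stream, Stream'.head_cons] at this
    exact (Bool.not_ne_self b) this
  induction u generalizing v with
  | nil =>
    cases v with
    | nil => rfl
    | cons b v => exact absurd h (hnil b v)
  | cons a u ih =>
    cases v with
    | nil => exact absurd (fun w => (h w).symm) (hnil a u)
    | cons b v =>
      have h1 := fun w => Stream'.cons_injective2 (h w)
      rw [(h1 default).1, ih fun w => (h1 w).2]

/-- An element of Thompson's group and the lower tree determine the upper tree. -/
theorem Represents.up_unique {D E : TreePair} {g : Equiv.Perm (Stream' Bool)}
    (hD : D.Represents g) (hE : E.Represents g) (h : D.down = E.down) : D.up = E.up := by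
  have aux : ∀ a b c : List (List Bool),
      List.Forall₂ (fun u v => ∀ w : Stream' Bool, g (v ++ₛ w) = u ++ₛ w) a c →
      List.Forall₂ (fun u v => ∀ w : Stream' Bool, g (v ++ₛ w) = u ++ₛ w) b c → a = b := by
    intro a b c h1 h2
    induction h1 generalizing b with
    | nil => cases h2; rfl
    | cons hx _ ih =>
      cases h2 with
      | cons hy hys =>
        rw [ih _ hys, append_stream_injective fun w => (hx w).symm.trans (hy w)]
  have hE' : List.Forall₂ _ E.up.addresses E.down.addresses := hE
  rw [← h] at hE'
  exact BTree.addresses_injective (aux _ _ _ hD hE')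

/-- The partition function is an invariant of the element of Thompson's group. -/
theorem Represents.partition_eq {D E : TreePair} {g : Equiv.Perm (Stream' Bool)}
    (hD : D.Represents g) (hE : E.Represents g) {w : ℂ} (hw : w ≠ 0) :
    D.partition S w = E.partition S w := by
  obtain ⟨R, hR1, hR2⟩ := BTree.exists_common D.down E.down
  obtain ⟨D', h1, h2, h3⟩ := hD.exists_down_eq (S := S) hw hR1
  obtain ⟨E', h4, h5, h6⟩ := hE.exists_down_eq (S := S) hw hR2
  have hdown := h2.trans h5.symm
  have hup := h1.up_unique h4 hdown
  rw [← h3, ← h6]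
  obtain ⟨_, _, _⟩ := D'
  obtain ⟨_, _, _⟩ := E'
  cases hup
  cases hdown
  rfl

theorem Represents.mul_inv {D E : TreePair} {g f : Equiv.Perm (Stream' Bool)}
    (hD : D.Represents g) (hE : E.Represents f) (h : D.down = E.down) :
    (⟨D.up, E.up, by rw [D.same, E.same, h]⟩ : TreePair).Represents (g * f⁻¹) := by
  have aux : ∀ a b c : List (List Bool),
      List.Forall₂ (fun u v => ∀ w : Stream' Bool, g (v ++ₛ w) = u ++ₛ w) a c →
      List.Forall₂ (fun u v => ∀ w : Stream' Bool, f (v ++ₛ w) = u ++ₛ w) b c →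
      List.Forall₂ (fun u v => ∀ w : Stream' Bool, (g * f⁻¹) (v ++ₛ w) = u ++ₛ w) a b := by
    intro a b c h1 h2
    induction h1 generalizing b with
    | nil => cases h2; exact List.Forall₂.nil
    | cons hx _ ih =>
      cases h2 with
      | cons hy hys =>
        refine List.Forall₂.cons (fun w => ?_) (ih _ hys)
        rw [Equiv.Perm.mul_apply, ← hy w, show f⁻¹ (f _) = _ from f.symm_apply_apply _, hx]
  have hE' : List.Forall₂ _ E.up.addresses E.down.addresses := hE
  rw [← h] at hE'
  exact aux _ _ _ hD hE'

theorem partition_of_size_eq (D : TreePair) (w : ℂ) {n : ℕ} (hn : D.size = n) :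
    D.partition S w = ((Fintype.card S : ℂ) ^ n)⁻¹ * ∑ σ : Fin n → S,
      D.up.pottsWeight w (extend σ) * D.down.pottsWeight w⁻¹ (extend σ) := by
  subst hn
  rfl

end TreePair

/-! ### The Jones function -/

theorem BTree.exists_common_refinement {ι : Type*} [Finite ι] (T : ι → BTree) :
    ∃ R, ∀ i, (T i).Refines R := by
  classical
  have := Fintype.ofFinite ι
  have h : ∀ s : Finset ι, ∃ R, ∀ i ∈ s, (T i).Refines R := by
    intro s
    induction s using Finset.induction_on with
    | empty => exact ⟨leaf, by simp⟩
    | insert j s _ ih =>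
      obtain ⟨R, hR⟩ := ih
      obtain ⟨R', h1, h2⟩ := BTree.exists_common (T j) R
      exact ⟨R', Finset.forall_mem_insert _ _ _ |>.2 ⟨h1, fun i hi => (hR i hi).trans h2⟩⟩
  obtain ⟨R, hR⟩ := h Finset.univ
  exact ⟨R, fun i => hR i (Finset.mem_univ i)⟩

theorem jonesFunction_eq_partition (S : Type*) [Fintype S] [DecidableEq S] [Inhabited S] {t : ℂ}
    (ht : t ≠ 0) (hS : (Fintype.card S : ℂ) = t + t⁻¹ + 2) {g : orientedF} {D : TreePair}
    (hD : D.Represents g.1.1) : jonesFunction t g = D.partition S t := by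
  have hA : (t ^ (-(1 / 4) : ℂ)) ^ (-4 : ℤ) = t := by
    rw [← Complex.cpow_mul_int]
    norm_num
  have hA0 : t ^ (-(1 / 4) : ℂ) ≠ 0 := fun h => ht ((Complex.cpow_eq_zero_iff _ _).1 h).1
  rw [jonesFunction, TreePair.normalizedJones_eq_partition _ S _ hA0 hA hS]
  exact (exists_colored g).choose_spec.choose_spec.1.partition_eq hD ht

/-- With respect to a common lower tree, `φ (gᵢ gⱼ⁻¹)` is the inner product of the vectors of Potts
weights of the upper trees of `gᵢ` and `gⱼ`. -/
theorem isPositiveType_jonesFunction (S : Type*) [Fintype S] [DecidableEq S] [Inhabited S] {t : ℂ}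
    (ht : t ≠ 0) (hconj : star t = t⁻¹) (hS : (Fintype.card S : ℂ) = t + t⁻¹ + 2) :
    IsPositiveType (jonesFunction t) := by
  intro r g
  choose D hD _ using fun i => (g i).2
  obtain ⟨R, hR⟩ := BTree.exists_common_refinement fun i => (D i).down
  choose E hE hdown _ using fun i => (hD i).exists_down_eq (S := S) ht (hR i)
  have hsize : ∀ i, (E i).up.leaves = R.leaves := fun i => (E i).same.trans (by rw [hdown i])
  let B : Matrix (Fin r) (Fin R.leaves → S) ℂ :=
    Matrix.of fun i σ => (E i).up.pottsWeight t (extend σ)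
  let P : Fin r → Fin r → TreePair := fun i j =>
    ⟨(E i).up, (E j).up, (hsize i).trans (hsize j).symm⟩
  have hP : ∀ i j, (P i j).Represents ((g i).1.1 * (g j).1.1⁻¹) := fun i j =>
    (hE i).mul_inv (hE j) ((hdown i).trans (hdown j).symm)
  have hval : ∀ i j, jonesFunction t (g i * (g j)⁻¹) = (P i j).partition S t := fun i j =>
    jonesFunction_eq_partition S ht hS (hP i j)
  have hM : (Matrix.of fun i j => jonesFunction t (g i * (g j)⁻¹)) =
      ((Fintype.card S : ℝ) ^ R.leaves)⁻¹ • (B * B.conjTranspose) := by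
    ext i j
    rw [Matrix.of_apply, hval, (P i j).partition_of_size_eq t (hsize i)]
    rw [Matrix.smul_apply, Matrix.mul_apply, Complex.real_smul]
    push_cast
    refine congrArg _ (Finset.sum_congr rfl fun σ _ => ?_)
    rw [Matrix.conjTranspose_apply]
    simp only [P, B, Matrix.of_apply, BTree.conj_pottsWeight hconj]
  rw [hM]
  exact (Matrix.posSemidef_self_mul_conjTranspose B).smul (by positivity)

/-- At these parameters `t + t⁻¹ + 2`, the square of the loop value, is `4`, `2` or `3`. -/
theorem exists_card_spins {t : ℂ}
    (ht : t = 1 ∨ t = Complex.I ∨ t = Complex.exp (Real.pi / 3 * Complex.I) ∨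
      t = Complex.exp (-(Real.pi / 3 * Complex.I))) :
    ∃ m : ℕ, (Fintype.card (Fin (m + 1)) : ℂ) = t + t⁻¹ + 2 ∧ t ≠ 0 ∧ star t = t⁻¹ := by
  have h3 : Complex.exp (Real.pi / 3 * Complex.I) +
      Complex.exp (-(Real.pi / 3 * Complex.I)) = 1 := by
    have h := Complex.two_cos (Real.pi / 3 : ℂ)
    have h' : Complex.cos (Real.pi / 3 : ℂ) = 1 / 2 := by
      have := congrArg (fun x : ℝ => (x : ℂ)) Real.cos_pi_div_three
      push_cast at this
      exact this
    rw [h', neg_mul] at h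
    rw [← h]
    norm_num
  have hc : star (Real.pi / 3 * Complex.I : ℂ) = -(Real.pi / 3 * Complex.I) := by
    simp [Complex.conj_ofReal]
  have hexp : ∀ z : ℂ, star z = -z → star (Complex.exp z) = (Complex.exp z)⁻¹ := by
    intro z hz
    rw [← Complex.exp_neg, ← hz]
    exact (Complex.exp_conj z).symm
  rcases ht with rfl | rfl | rfl | rfl
  · exact ⟨3, by norm_num, one_ne_zero, by simp⟩
  · exact ⟨1, by norm_num, Complex.I_ne_zero, by simp⟩
  · refine ⟨2, ?_, Complex.exp_ne_zero _, hexp _ hc⟩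
    rw [← Complex.exp_neg, h3]
    norm_num
  · refine ⟨2, ?_, Complex.exp_ne_zero _, hexp _ (by rw [star_neg, hc])⟩
    rw [← Complex.exp_neg, neg_neg, add_comm (Complex.exp _), h3]
    norm_num

end

end JonesThompson

/-- For `t = 1, i, e^{± iπ/3}` the renormalized Jones function `V_g(t)` does not depend on the
choices made (pair of trees, value of `t^{-1/4}`), and it is of positive type. -/
theorem theorem3p15 (t : ℂ)
    (ht : t = 1 ∨ t = Complex.I ∨ t = Complex.exp (Real.pi / 3 * Complex.I) ∨
      t = Complex.exp (-(Real.pi / 3 * Complex.I))) :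
    (∀ (g : JonesThompson.orientedF) (D : JonesThompson.TreePair)
        (c : D.graph.Coloring Bool) (A : ℂ),
        D.Represents g.1.1 → c D.first = true → A ^ (-4 : ℤ) = t →
        JonesThompson.jonesFunction t g = D.normalizedJones c A) ∧
      JonesThompson.IsPositiveType (JonesThompson.jonesFunction t) := by
  obtain ⟨m, hS, ht0, hconj⟩ := JonesThompson.exists_card_spins ht
  refine ⟨fun g D c A hD _ hA => ?_,
    JonesThompson.isPositiveType_jonesFunction (Fin (m + 1)) ht0 hconj hS⟩
  have hA0 : A ≠ 0 := by
    rintro rfl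
    exact ht0 (by rw [← hA]; norm_num)
  rw [JonesThompson.jonesFunction_eq_partition (Fin (m + 1)) ht0 hS hD,
    D.normalizedJones_eq_partition (Fin (m + 1)) c hA0 hA hS]
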